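/- Let $\Gamma=\langle a,b : a^2=b^2=e\rangle$ be the infinite dihedral group acting self-similarly on words over $\mathbf{X}=\{0,1\}$ by $$a\cdot(0w)=1w,\quad a\cdot(1w)=0w,\quad b\cdot(0w)=0(a\cdot w),\quad b\cdot(1w)=1(b\cdot w).$$ Let $\mathbf{X}^\infty$ be the Cantor space of infinite words over $\mathbf X$, with the induced action of $\Gamma$, and let $Z(\beta)\subseteq\mathbf{X}^\infty$ be the set of infinite words with prefix $\beta$. Let $\mathcal{G}$ be the (Hausdorff, étale) groupoid of germs $[\alpha,g,\beta;x]$, $x\in Z(\beta)$, of the local homeomorphisms $S_{(\alpha,g,\beta)}:Z(\beta)\to Z(\alpha)$, $\beta y\mapsto\alpha(g\cdot y)$, for finite words $\alpha,\beta$ and $g\in\Gamma$; its topology has as a basis the sets $\{[\alpha,g,\beta;x]:x\in U\}$ with $U\subseteq Z(\beta)$ open. Let $c:\mathcal{G}\to\mathbb{Z}$, $c([\alpha,g,\beta;x])=|\alpha|-|\beta|$, be the canonical cocycle, let $\mathcal{H}=c^{-1}(0)$, and for $n\ge 0$ let $\mathcal{H}_n=\{[\alpha,g,\beta;x]:|\alpha|=|\beta|=n\}$.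 These are open subgroupoids with $\mathcal{H}_n\subseteq\mathcal{H}_{n+1}$ and $\mathcal{H}=\bigcup_n\mathcal{H}_n$. For a Hausdorff étale groupoid $\mathcal{K}$ with source $s$ and range $r$, let $H_*(\mathcal{K})$ be the homology of the complex $$0\longleftarrow C_c(\mathcal{K}^{(0)},\mathbb{Z})\xleftarrow{\ \delta_1\ }C_c(\mathcal{K}^{(1)},\mathbb{Z})\xleftarrow{\ \delta_2\ }C_c(\mathcal{K}^{(2)},\mathbb{Z})\longleftarrow\cdots,$$ where $\mathcal{K}^{(n)}$ is the space of composable strings of $n$ arrows, $\delta_1=s_*-r_*$, $\delta_2=d_{0*}-d_{1*}+d_{2*}$ with $d_0(g,h)=h$, $d_1(g,h)=gh$, $d_2(g,h)=g$, and $\pi_*f(y)=\sum_{\pi(x)=y}f(x)$ for a local homeomorphism $\pi$. Then $$H_0(\mathcal{H})\cong\mathbb{Z}[1/2]\qquad\text{and}\qquad H_1(\mathcal{H})\cong\mathbb{Z}/2\mathbb{Z}.$$ Moreover, for $k=0,1$, the maps $H_k(\mathcal{H}_n)\to H_k(\mathcal{H})$ induced by the inclusions identify $H_k(\mathcal{H})$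 with the inductive limit $\varinjlim_n H_k(\mathcal{H}_n)$ along the maps induced by the inclusions $\mathcal{H}_n\subseteq\mathcal{H}_m$, $n\le m$. -/

import Mathlib

open Topology CompactlySupported


theorem isLocalHomeomorph_of_isOpenMap {X Y : Type*} [TopologicalSpace X] [TopologicalSpace Y]
    {f : X → Y} (hc : Continuous f) (ho : IsOpenMap f)
    (hi : ∀ x, ∃ U : Set X, IsOpen U ∧ x ∈ U ∧ Set.InjOn f U) : IsLocalHomeomorph f := by
  rw [isLocalHomeomorph_iff_isLocalHomeomorphOn_univ,
    isLocalHomeomorphOn_iff_isOpenEmbedding_restrict]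
  intro x _
  obtain ⟨U, hU, hx, hinj⟩ := hi x
  refine ⟨U, hU.mem_nhds hx, ?_⟩
  exact .of_continuous_injective_isOpenMap (hc.comp continuous_subtype_val)
    (Set.injOn_iff_injective.mp hinj) (ho.comp hU.isOpenMap_subtype_val)

/-- The base change of a local homeomorphism is a local homeomorphism. -/
theorem isLocalHomeomorph_pullback_fst {A B S : Type*} [TopologicalSpace A] [TopologicalSpace B]
    [TopologicalSpace S] {f : A → S} {g : B → S} (hf : Continuous f) (hg : IsLocalHomeomorph g) :
    IsLocalHomeomorph (fun p : {p : A × B // f p.1 = g p.2} => p.1.1) := by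
  refine isLocalHomeomorph_of_isOpenMap (by fun_prop) ?_ ?_
  · rw [isOpenMap_iff_nhds_le]
    rintro ⟨⟨a, b⟩, hab⟩
    intro s hs
    rw [Filter.mem_map, nhds_subtype_eq_comap, Filter.mem_comap] at hs
    obtain ⟨t, ht, hts⟩ := hs
    rw [nhds_prod_eq, Filter.mem_prod_iff] at ht
    obtain ⟨u, hu, v, hv, huv⟩ := ht
    have h1 : g '' v ∈ 𝓝 (f a) := by
      have h0 : f a = g b := hab
      rw [h0, ← hg.map_nhds_eq b]
      exact Filter.image_mem_map hv
    filter_upwards [hu, hf.continuousAt h1] with a' ha' hb'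
    obtain ⟨b', hb', he⟩ := hb'
    exact hts (a := ⟨(a', b'), he.symm⟩) (huv ⟨ha', hb'⟩)
  · rintro ⟨⟨a, b⟩, hab⟩
    obtain ⟨e, hbe, rfl⟩ := hg b
    refine ⟨{p | p.1.2 ∈ e.source}, e.open_source.preimage (by fun_prop), hbe, ?_⟩
    rintro ⟨⟨a1, b1⟩, h1⟩ hp1 ⟨⟨a2, b2⟩, h2⟩ hp2 h12
    obtain rfl : a1 = a2 := h12
    have : b1 = b2 := e.injOn hp1 hp2 (h1.symm.trans h2)
    subst this
    rfl

theorem isLocalHomeomorph_pullback_snd {A B S : Type*} [TopologicalSpace A] [TopologicalSpace B]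
    [TopologicalSpace S] {f : A → S} {g : B → S} (hf : IsLocalHomeomorph f) (hg : Continuous g) :
    IsLocalHomeomorph (fun p : {p : A × B // f p.1 = g p.2} => p.1.2) := by
  let φ : {p : A × B // f p.1 = g p.2} ≃ₜ {p : B × A // g p.1 = f p.2} :=
    { toFun := fun p => ⟨(p.1.2, p.1.1), p.2.symm⟩
      invFun := fun p => ⟨(p.1.2, p.1.1), p.2.symm⟩
      left_inv := fun _ => rfl
      right_inv := fun _ => rfl
      continuous_toFun := by fun_prop
      continuous_invFun := by fun_prop }
  exact (isLocalHomeomorph_pullback_fst hg hf).comp φ.isLocalHomeomorph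

section Pushforward

variable {X Y Z : Type*} [TopologicalSpace X] [TopologicalSpace Y] [TopologicalSpace Z]

theorem finite_fiber_inter_support {π : X → Y} (hπ : IsLocalHomeomorph π) [T2Space Y]
    (f : C_c(X, ℤ)) (y : Y) : ({x | π x = y} ∩ Function.support f).Finite := by
  have hK : IsCompact (tsupport f) := f.hasCompactSupport'
  refine Set.Finite.subset (s := {x | π x = y} ∩ tsupport f) ?_
    (Set.inter_subset_inter_right _ (subset_tsupport _))
  have hc : IsCompact ({x | π x = y} ∩ tsupport f) :=
    hK.inter_left (isClosed_singleton.preimage hπ.continuous)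
  refine hc.finite ?_
  rw [isDiscrete_iff_forall_mem_exists_isOpen]
  rintro x ⟨hx, hx'⟩
  obtain ⟨e, hxe, rfl⟩ := hπ x
  refine ⟨e.source, e.open_source, ?_⟩
  ext z
  simp only [Set.mem_inter_iff, Set.mem_ofPred_eq, Set.mem_singleton_iff]
  constructor
  · rintro ⟨h1, h2, h3⟩
    exact e.injOn h1 hxe (h2.trans (Eq.symm hx))
  · rintro rfl
    exact ⟨hxe, hx, hx'⟩

theorem continuous_fiberSum {π : X → Y} (hπ : IsLocalHomeomorph π) [T2Space X] [T2Space Y]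
    (f : C_c(X, ℤ)) : Continuous fun y => ∑ᶠ x ∈ {x | π x = y}, f x := by
  classical
  have hK : IsCompact (tsupport f) := f.hasCompactSupport'
  rw [continuous_iff_continuousAt]
  intro y
  set F := {x | π x = y} ∩ Function.support f with hF
  have hfin : F.Finite := finite_fiber_inter_support hπ f y
  obtain ⟨U, hU, hdisj⟩ := hfin.t2_separation
  choose e he hπe using hπ
  have hW : ∀ x, ∃ W : Set X, IsOpen W ∧ x ∈ W ∧ W ⊆ U x ∧ W ⊆ (e x).source ∧
      ∀ z ∈ W, f z = f x := fun x => by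
    refine ⟨U x ∩ (e x).source ∩ f ⁻¹' {f x}, ((hU x).2.inter (e x).open_source).inter
      ((isOpen_discrete _).preimage f.continuous), ⟨⟨(hU x).1, he x⟩, rfl⟩, ?_, ?_, ?_⟩
    · exact fun z hz => hz.1.1
    · exact fun z hz => hz.1.2
    · exact fun z hz => hz.2
  choose W hWo hxW hWU hWe hWf using hW
  have hπ' : IsLocalHomeomorph π := fun x => ⟨e x, he x, hπe x⟩
  have hA : (⋂ x ∈ F, π '' W x) ∈ 𝓝 y := by
    rw [Filter.biInter_mem hfin]
    intro x hx
    have hxy : π x = y := hx.1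
    exact (hπ'.isOpenMap _ (hWo x)).mem_nhds ⟨x, hxW x, hxy⟩
  have hB : (π '' (tsupport f \ ⋃ x ∈ F, W x))ᶜ ∈ 𝓝 y := by
    have hcl : IsClosed (π '' (tsupport f \ ⋃ x ∈ F, W x)) :=
      ((hK.diff (isOpen_biUnion fun x _ => hWo x)).image hπ'.continuous).isClosed
    refine hcl.isOpen_compl.mem_nhds ?_
    rintro ⟨x, ⟨hx1, hx2⟩, hxy⟩
    have hts : tsupport f = Function.support f := by
      refine IsClosed.closure_eq ?_
      exact (isClosed_discrete ({0}ᶜ : Set ℤ)).preimage f.continuous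
    rw [hts] at hx1
    exact hx2 (Set.mem_biUnion (show x ∈ F from ⟨hxy, hx1⟩) (hxW x))
  have key : ∀ y' ∈ (⋂ x ∈ F, π '' W x) ∩ (π '' (tsupport f \ ⋃ x ∈ F, W x))ᶜ,
      ∑ᶠ x ∈ {x | π x = y'}, f x = ∑ x ∈ hfin.toFinset, f x := by
    rintro y' ⟨h1, h2⟩
    simp only [Set.mem_iInter] at h1
    choose! t ht using h1
    have hinj : Set.InjOn t (hfin.toFinset : Set X) := by
      intro x hx x' hx' hxx
      have hx : x ∈ F := by simpa using hx
      have hx' : x' ∈ F := by simpa using hx'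
      by_contra hne
      exact Set.disjoint_left.mp (hdisj hx hx' hne) (hWU x (ht x hx).1)
        (hxx ▸ hWU x' (ht x' hx').1)
    have : ∑ᶠ x ∈ {x | π x = y'}, f x = ∑ x ∈ hfin.toFinset.image t, f x := by
      refine finsum_mem_eq_sum_of_inter_support_eq _ ?_
      ext z
      simp only [Set.mem_inter_iff, Set.mem_ofPred_eq, Finset.coe_image, Set.Finite.coe_toFinset,
        Set.mem_image]
      constructor
      · rintro ⟨hz, hz'⟩
        refine ⟨?_, hz'⟩
        have : z ∈ ⋃ x ∈ F, W x := by
          by_contra hcon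
          exact h2 ⟨z, ⟨subset_tsupport _ hz', hcon⟩, hz⟩
        simp only [Set.mem_iUnion] at this
        obtain ⟨x, hx, hzx⟩ := this
        refine ⟨x, hx, (e x).injOn (hWe x (ht x hx).1) (hWe x hzx) ?_⟩
        rw [← hπe x, (ht x hx).2, hz]
      · rintro ⟨⟨x, hx, rfl⟩, hz⟩
        exact ⟨(ht x hx).2, hz⟩
    rw [this, Finset.sum_image hinj]
    exact Finset.sum_congr rfl fun x hx => hWf x _ (ht x (by simpa using hx)).1
  have hev : (fun y => ∑ᶠ x ∈ {x | π x = y}, f x) =ᶠ[𝓝 y]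
      fun _ => ∑ x ∈ hfin.toFinset, f x :=
    Filter.eventually_of_mem (Filter.inter_mem hA hB) key
  exact continuousAt_const.congr hev.symm

/-- The homomorphism `π_* : C_c(X, ℤ) → C_c(Y, ℤ)`, `π_* f (y) = ∑_{π x = y} f x`, induced by a
local homeomorphism `π : X → Y` of Hausdorff spaces. -/
noncomputable def pushforward [T2Space X] [T2Space Y] (π : X → Y) (hπ : IsLocalHomeomorph π) :
    C_c(X, ℤ) →+ C_c(Y, ℤ) where
  toFun f :=
    { toFun := fun y => ∑ᶠ x ∈ {x | π x = y}, f x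
      continuous_toFun := continuous_fiberSum hπ f
      hasCompactSupport' := by
        refine HasCompactSupport.intro
          (IsCompact.image (f.hasCompactSupport' : IsCompact (tsupport f)) hπ.continuous) ?_
        intro y hy
        refine finsum_mem_eq_zero_of_forall_eq_zero fun x hx => ?_
        by_contra hne
        exact hy ⟨x, subset_tsupport _ hne, hx⟩ }
  map_zero' := by
    ext y
    exact finsum_mem_eq_zero_of_forall_eq_zero fun _ _ => rfl
  map_add' f g := by
    ext y
    exact finsum_mem_add_distrib' (finite_fiber_inter_support hπ f y)
      (finite_fiber_inter_support hπ g y)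

theorem pushforward_apply [T2Space X] [T2Space Y] (π : X → Y) (hπ : IsLocalHomeomorph π)
    (f : C_c(X, ℤ)) (y : Y) : pushforward π hπ f y = ∑ᶠ x ∈ {x | π x = y}, f x := rfl

theorem pushforward_comp [T2Space X] [T2Space Y] [T2Space Z] {π : X → Y} {ρ : Y → Z}
    (hπ : IsLocalHomeomorph π) (hρ : IsLocalHomeomorph ρ) (f : C_c(X, ℤ)) :
    pushforward ρ hρ (pushforward π hπ f) = pushforward (ρ ∘ π) (hρ.comp hπ) f := by
  classical
  ext z
  simp only [pushforward_apply]
  have h0 := finite_fiber_inter_support (hρ.comp hπ) f z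
  have hm : ∀ x, x ∈ h0.toFinset ↔ ρ (π x) = z ∧ f x ≠ 0 := fun x => by simp
  have hin : ∀ y ∈ {y | ρ y = z},
      ∑ᶠ x ∈ {x | π x = y}, f x = ∑ x ∈ h0.toFinset with π x = y, f x := by
    intro y hy
    obtain rfl : ρ y = z := hy
    refine finsum_mem_eq_sum_of_inter_support_eq f ?_
    ext x
    simp only [Set.mem_inter_iff, Set.mem_ofPred_eq, Function.mem_support, Finset.coe_filter, hm]
    constructor
    · rintro ⟨rfl, h⟩
      exact ⟨⟨⟨rfl, h⟩, rfl⟩, h⟩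
    · rintro ⟨⟨⟨_, h⟩, rfl⟩, _⟩
      exact ⟨rfl, h⟩
  rw [finsum_mem_eq_sum_of_inter_support_eq (t := h0.toFinset) (s := {x | (ρ ∘ π) x = z}) f
      (by ext x; simp), finsum_mem_congr rfl hin,
    finsum_mem_eq_sum_of_inter_support_eq (t := h0.toFinset.image π)]
  · rw [Finset.sum_fiberwise_of_maps_to fun x hx => Finset.mem_image_of_mem π hx]
  · ext y
    simp only [Set.mem_inter_iff, Set.mem_ofPred_eq, Function.mem_support, Finset.mem_coe,
      Finset.mem_image, hm]
    constructor
    · rintro ⟨rfl, h⟩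
      refine ⟨?_, h⟩
      obtain ⟨x, hx, -⟩ := Finset.exists_ne_zero_of_sum_ne_zero h
      rw [Finset.mem_filter, hm] at hx
      exact ⟨x, hx⟩
    · rintro ⟨⟨x, ⟨h1, -⟩, rfl⟩, h⟩
      exact ⟨h1, h⟩

end Pushforward

/-- A Hausdorff étale groupoid: a topological groupoid with space of units `Ob`, space of
arrows `Arr` (both Hausdorff; `one` identifies `Ob` with the units in `Arr`), and whose source and range maps are local homeomorphisms.
The product `mul g h` is defined when `src g = rng h`. -/
structure EtaleGroupoid where
  Ob : Type
  Arr : Type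
  [topOb : TopologicalSpace Ob]
  [topArr : TopologicalSpace Arr]
  [t2Ob : T2Space Ob]
  [t2Arr : T2Space Arr]
  src : Arr → Ob
  rng : Arr → Ob
  one : Ob → Arr
  inv : Arr → Arr
  mul : (g h : Arr) → src g = rng h → Arr
  src_one : ∀ x, src (one x) = x
  rng_one : ∀ x, rng (one x) = x
  src_inv : ∀ g, src (inv g) = rng g
  rng_inv : ∀ g, rng (inv g) = src g
  src_mul : ∀ g h e, src (mul g h e) = src h
  rng_mul : ∀ g h e, rng (mul g h e) = rng g
  one_mul : ∀ g, mul (one (rng g)) g (src_one _) = g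
  mul_one : ∀ g, mul g (one (src g)) (rng_one _).symm = g
  mul_assoc : ∀ g h k (e₁ : src g = rng h) (e₂ : src h = rng k),
    mul (mul g h e₁) k ((src_mul g h e₁).trans e₂) =
      mul g (mul h k e₂) (e₁.trans (rng_mul h k e₂).symm)
  inv_mul : ∀ g, mul (inv g) g (src_inv g) = one (src g)
  mul_inv : ∀ g, mul g (inv g) (rng_inv g).symm = one (rng g)
  continuous_one : Continuous one
  continuous_inv : Continuous inv
  continuous_mul : Continuous fun p : {p : Arr × Arr // src p.1 = rng p.2} => mul p.1.1 p.1.2 p.2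
  isLocalHomeomorph_src : IsLocalHomeomorph src
  isLocalHomeomorph_rng : IsLocalHomeomorph rng

namespace EtaleGroupoid

attribute [instance] topOb topArr t2Ob t2Arr

section Homology

variable (G : EtaleGroupoid)

/-- The space of composable pairs of arrows. -/
abbrev Comp₂ : Type := {p : G.Arr × G.Arr // G.src p.1 = G.rng p.2}

/-- The face maps `(g, h) ↦ h`, `(g, h) ↦ gh`, `(g, h) ↦ g`. -/
def d₀ (p : G.Comp₂) : G.Arr := p.1.2

def d₁ (p : G.Comp₂) : G.Arr := G.mul p.1.1 p.1.2 p.2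

def d₂ (p : G.Comp₂) : G.Arr := p.1.1

theorem isLocalHomeomorph_d₀ : IsLocalHomeomorph G.d₀ :=
  isLocalHomeomorph_pullback_snd G.isLocalHomeomorph_src G.isLocalHomeomorph_rng.continuous

theorem isLocalHomeomorph_d₂ : IsLocalHomeomorph G.d₂ :=
  isLocalHomeomorph_pullback_fst G.isLocalHomeomorph_src.continuous G.isLocalHomeomorph_rng

theorem isLocalHomeomorph_d₁ : IsLocalHomeomorph G.d₁ := by
  refine IsLocalHomeomorph.of_comp (g := G.src) ?_ G.isLocalHomeomorph_src G.continuous_mul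
  have : G.src ∘ G.d₁ = G.src ∘ G.d₀ := funext fun p => G.src_mul _ _ _
  rw [this]
  exact G.isLocalHomeomorph_src.comp G.isLocalHomeomorph_d₀

/-- `δ₁ = s_* - r_* : C_c(G⁽¹⁾, ℤ) → C_c(G⁽⁰⁾, ℤ)`. -/
noncomputable def δ₁ : C_c(G.Arr, ℤ) →+ C_c(G.Ob, ℤ) :=
  pushforward G.src G.isLocalHomeomorph_src - pushforward G.rng G.isLocalHomeomorph_rng

/-- `δ₂ = d₀_* - d₁_* + d₂_* : C_c(G⁽²⁾, ℤ) → C_c(G⁽¹⁾, ℤ)`. -/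
noncomputable def δ₂ : C_c(G.Comp₂, ℤ) →+ C_c(G.Arr, ℤ) :=
  pushforward G.d₀ G.isLocalHomeomorph_d₀ - pushforward G.d₁ G.isLocalHomeomorph_d₁ +
    pushforward G.d₂ G.isLocalHomeomorph_d₂

/-- `H₀(G) = C_c(G⁽⁰⁾, ℤ) / im δ₁`. -/
abbrev H₀ : Type := C_c(G.Ob, ℤ) ⧸ G.δ₁.range

/-- `H₁(G) = ker δ₁ / im δ₂`. -/
abbrev H₁ : Type := G.δ₁.ker ⧸ G.δ₂.range.addSubgroupOf G.δ₁.ker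

/-- `δ₁ ∘ δ₂ = 0`. -/
theorem δ₁_δ₂ (f : C_c(G.Comp₂, ℤ)) : G.δ₁ (G.δ₂ f) = 0 := by
  have h1 : G.src ∘ G.d₁ = G.src ∘ G.d₀ := funext fun p => G.src_mul _ _ _
  have h2 : G.rng ∘ G.d₁ = G.rng ∘ G.d₂ := funext fun p => G.rng_mul _ _ _
  have h3 : G.src ∘ G.d₂ = G.rng ∘ G.d₀ := funext fun p => p.2
  simp only [δ₁, δ₂, AddMonoidHom.sub_apply, AddMonoidHom.add_apply, map_add, map_sub,
    pushforward_comp, h1, h2, h3]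
  abel

end Homology

/-- A homomorphism of étale groupoids that is a local homeomorphism on units and on arrows. -/
structure EtaleHom (G K : EtaleGroupoid) where
  onOb : G.Ob → K.Ob
  onArr : G.Arr → K.Arr
  isLocalHomeomorph_onOb : IsLocalHomeomorph onOb
  isLocalHomeomorph_onArr : IsLocalHomeomorph onArr
  src_onArr : ∀ g, K.src (onArr g) = onOb (G.src g)
  rng_onArr : ∀ g, K.rng (onArr g) = onOb (G.rng g)
  map_mul : ∀ g h e, onArr (G.mul g h e) = K.mul (onArr g) (onArr h)
    (by rw [src_onArr, rng_onArr, e])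

namespace EtaleHom

variable {G K : EtaleGroupoid} (φ : EtaleHom G K)

def onComp₂ (p : G.Comp₂) : K.Comp₂ :=
  ⟨(φ.onArr p.1.1, φ.onArr p.1.2), by rw [φ.src_onArr, φ.rng_onArr, p.2]⟩

theorem isLocalHomeomorph_onComp₂ : IsLocalHomeomorph φ.onComp₂ := by
  refine IsLocalHomeomorph.of_comp (g := K.d₂) ?_ K.isLocalHomeomorph_d₂ ?_
  · exact φ.isLocalHomeomorph_onArr.comp G.isLocalHomeomorph_d₂
  · have := φ.isLocalHomeomorph_onArr.continuous
    unfold onComp₂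
    fun_prop

/-- The chain maps induced by `φ`. -/
noncomputable def chain₀ : C_c(G.Ob, ℤ) →+ C_c(K.Ob, ℤ) :=
  pushforward φ.onOb φ.isLocalHomeomorph_onOb

noncomputable def chain₁ : C_c(G.Arr, ℤ) →+ C_c(K.Arr, ℤ) :=
  pushforward φ.onArr φ.isLocalHomeomorph_onArr

noncomputable def chain₂ : C_c(G.Comp₂, ℤ) →+ C_c(K.Comp₂, ℤ) :=
  pushforward φ.onComp₂ φ.isLocalHomeomorph_onComp₂

theorem δ₁_chain₁ (f : C_c(G.Arr, ℤ)) : K.δ₁ (φ.chain₁ f) = φ.chain₀ (G.δ₁ f) := by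
  have h1 : K.src ∘ φ.onArr = φ.onOb ∘ G.src := funext φ.src_onArr
  have h2 : K.rng ∘ φ.onArr = φ.onOb ∘ G.rng := funext φ.rng_onArr
  simp only [δ₁, chain₁, chain₀, AddMonoidHom.sub_apply, map_sub, pushforward_comp, h1, h2]

theorem δ₂_chain₂ (f : C_c(G.Comp₂, ℤ)) : K.δ₂ (φ.chain₂ f) = φ.chain₁ (G.δ₂ f) := by
  have h0 : K.d₀ ∘ φ.onComp₂ = φ.onArr ∘ G.d₀ := rfl
  have h1 : K.d₁ ∘ φ.onComp₂ = φ.onArr ∘ G.d₁ := funext fun p => (φ.map_mul _ _ _).symm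
  have h2 : K.d₂ ∘ φ.onComp₂ = φ.onArr ∘ G.d₂ := rfl
  simp only [δ₂, chain₁, chain₂, AddMonoidHom.sub_apply, AddMonoidHom.add_apply, map_add, map_sub,
    pushforward_comp, h0, h1, h2]

/-- The map `H₀(G) → H₀(K)` induced by `φ`. -/
noncomputable def mapH₀ : G.H₀ →+ K.H₀ :=
  QuotientAddGroup.map _ _ φ.chain₀ (by
    rintro _ ⟨f, rfl⟩
    exact ⟨φ.chain₁ f, φ.δ₁_chain₁ f⟩)

/-- The map `ker δ₁ → ker δ₁` induced by `φ`. -/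
noncomputable def cycles₁ : G.δ₁.ker →+ K.δ₁.ker :=
  (φ.chain₁.comp G.δ₁.ker.subtype).codRestrict K.δ₁.ker (fun f => by
    have hf : G.δ₁ f.1 = 0 := f.2
    show K.δ₁ (φ.chain₁ f.1) = 0
    rw [φ.δ₁_chain₁, hf, map_zero])

/-- The map `H₁(G) → H₁(K)` induced by `φ`. -/
noncomputable def mapH₁ : G.H₁ →+ K.H₁ :=
  QuotientAddGroup.map _ _ φ.cycles₁ (by
    rintro ⟨f, hf⟩ ⟨g, hg⟩
    exact ⟨φ.chain₂ g, (φ.δ₂_chain₂ g).trans (congrArg φ.chain₁ hg)⟩)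

end EtaleHom

/-- An open subgroupoid with the same units. -/
structure OpenSubgroupoid (G : EtaleGroupoid) where
  carrier : Set G.Arr
  isOpen_carrier : IsOpen carrier
  one_mem : ∀ x, G.one x ∈ carrier
  inv_mem : ∀ g ∈ carrier, G.inv g ∈ carrier
  mul_mem : ∀ g h e, g ∈ carrier → h ∈ carrier → G.mul g h e ∈ carrier

namespace OpenSubgroupoid

variable {G : EtaleGroupoid}

/-- An open subgroupoid as an étale groupoid, with the subspace topology. -/
def toEtale (K : OpenSubgroupoid G) : EtaleGroupoid where
  Ob := G.Ob
  Arr := K.carrier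
  src g := G.src g
  rng g := G.rng g
  one x := ⟨G.one x, K.one_mem x⟩
  inv g := ⟨G.inv g, K.inv_mem _ g.2⟩
  mul g h e := ⟨G.mul g h e, K.mul_mem _ _ e g.2 h.2⟩
  src_one x := G.src_one x
  rng_one x := G.rng_one x
  src_inv g := G.src_inv g
  rng_inv g := G.rng_inv g
  src_mul g h e := G.src_mul g h e
  rng_mul g h e := G.rng_mul g h e
  one_mul g := Subtype.ext (G.one_mul g)
  mul_one g := Subtype.ext (G.mul_one g)
  mul_assoc g h k e₁ e₂ := Subtype.ext (G.mul_assoc g h k e₁ e₂)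
  inv_mul g := Subtype.ext (G.inv_mul g)
  mul_inv g := Subtype.ext (G.mul_inv g)
  continuous_one := G.continuous_one.subtype_mk _
  continuous_inv := (G.continuous_inv.comp continuous_subtype_val).subtype_mk _
  continuous_mul := by
    refine Continuous.subtype_mk (f := fun p : {p : K.carrier × K.carrier //
      G.src p.1 = G.rng p.2} => G.mul p.1.1 p.1.2 p.2) ?_ _
    exact G.continuous_mul.comp (f := fun p : {p : K.carrier × K.carrier //
      G.src p.1 = G.rng p.2} => (⟨(p.1.1.1, p.1.2.1), p.2⟩ : G.Comp₂)) (by fun_prop)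
  isLocalHomeomorph_src :=
    G.isLocalHomeomorph_src.comp K.isOpen_carrier.isOpenEmbedding_subtypeVal.isLocalHomeomorph
  isLocalHomeomorph_rng :=
    G.isLocalHomeomorph_rng.comp K.isOpen_carrier.isOpenEmbedding_subtypeVal.isLocalHomeomorph

/-- The inclusion of an open subgroupoid in a larger one. -/
def inclusion {K L : OpenSubgroupoid G} (h : K.carrier ⊆ L.carrier) :
    EtaleHom K.toEtale L.toEtale where
  onOb := id
  onArr := Set.inclusion h
  isLocalHomeomorph_onOb := (Homeomorph.refl G.Ob).isLocalHomeomorph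
  isLocalHomeomorph_onArr :=
    (IsOpenEmbedding.inclusion h (K.isOpen_carrier.preimage
      continuous_subtype_val)).isLocalHomeomorph
  src_onArr _ := rfl
  rng_onArr _ := rfl
  map_mul _ _ _ := rfl

end OpenSubgroupoid

end EtaleGroupoid
namespace SelfSimilarDihedral

/-- The infinite dihedral group `⟨a, b : a² = b² = e⟩`; its elements are `r i = (ab)ⁱ` and
`sr i = a(ab)ⁱ` for `i : ℤ`. -/
abbrev Γ : Type := DihedralGroup 0

def a : Γ := .sr (0 : ℤ)

def b : Γ := .sr (1 : ℤ)

/-- The letter `g · x`, for the alphabet `{0, 1}` with `0 = false` and `1 = true`. -/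
def out : Γ → Bool → Bool
  | .r (i : ℤ), x => if Even i then x else !x
  | .sr (i : ℤ), x => if Even i then !x else x

/-- The section `g|_x`. -/
def sec : Γ → Bool → Γ
  | .r (i : ℤ), false => if Even i then .r (-(i / 2) : ℤ) else .sr (-(i / 2) : ℤ)
  | .r (i : ℤ), true => if Even i then .r (i / 2 : ℤ) else .sr (i / 2 + 1 : ℤ)
  | .sr (i : ℤ), false => if Even i then .r (-(i / 2) : ℤ) else .sr (-(i / 2) : ℤ)
  | .sr (i : ℤ), true => if Even i then .r (i / 2 : ℤ) else .sr (i / 2 + 1 : ℤ)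

/-- The relations `a·0 = 1·e`, `a·1 = 0·e`, `b·0 = 0·a`, `b·1 = 1·b` defining the self-similar
action; together with the cocycle rules `out_mul`, `sec_mul` they determine `out` and `sec`. -/
theorem relations : (out a false = true ∧ sec a false = 1) ∧ (out a true = false ∧ sec a true = 1) ∧
    (out b false = false ∧ sec b false = a) ∧ (out b true = true ∧ sec b true = b) := by
  decide

theorem sq_relations : a * a = 1 ∧ b * b = 1 := by decide

theorem closure_ab : Subgroup.closure {a, b} = ⊤ := by
  have ha : a ∈ Subgroup.closure {a, b} := Subgroup.subset_closure (by simp)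
  have hb : b ∈ Subgroup.closure {a, b} := Subgroup.subset_closure (by simp)
  have hr : ∀ i : ℤ, (DihedralGroup.r i : Γ) ∈ Subgroup.closure {a, b} := fun i => by
    have h1 : (DihedralGroup.r i : Γ) = (a * b) ^ i := by
      have h2 : a * b = DihedralGroup.r (1 : ZMod 0) := by decide
      rw [h2, DihedralGroup.r_one_zpow]
      rfl
    rw [h1]
    exact Subgroup.zpow_mem _ (mul_mem ha hb) _
  rw [eq_top_iff]
  rintro (i | i) -
  · exact hr i
  · have : (DihedralGroup.sr i : Γ) = a * DihedralGroup.r i := by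
      show _ = DihedralGroup.sr ((0 : ZMod 0) + i)
      rw [zero_add]
    rw [this]
    exact mul_mem ha (hr i)

theorem out_one (x : Bool) : out 1 x = x := by revert x; decide

theorem sec_one (x : Bool) : sec 1 x = 1 := by revert x; decide

theorem r_mul_r (i j : ℤ) : (DihedralGroup.r i : Γ) * DihedralGroup.r j = DihedralGroup.r (i + j : ℤ) := rfl
theorem r_mul_sr (i j : ℤ) : (DihedralGroup.r i : Γ) * DihedralGroup.sr j = DihedralGroup.sr (j - i : ℤ) := rfl
theorem sr_mul_r (i j : ℤ) : (DihedralGroup.sr i : Γ) * DihedralGroup.r j = DihedralGroup.sr (i + j : ℤ) := rfl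
theorem sr_mul_sr (i j : ℤ) : (DihedralGroup.sr i : Γ) * DihedralGroup.sr j = DihedralGroup.r (j - i : ℤ) := rfl

theorem r_inj (i j : ℤ) : (DihedralGroup.r i : Γ) = DihedralGroup.r j ↔ i = j := by
  constructor
  · intro h; injection h
  · rintro rfl; rfl
theorem sr_inj (i j : ℤ) : (DihedralGroup.sr i : Γ) = DihedralGroup.sr j ↔ i = j := by
  constructor
  · intro h; injection h
  · rintro rfl; rfl

theorem out_mul (g h : Γ) (x : Bool) : out (g * h) x = out g (out h x) := by
  rcases g with (i : ℤ) | (i : ℤ) <;> rcases h with (j : ℤ) | (j : ℤ) <;>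
    simp only [r_mul_r, r_mul_sr, sr_mul_r, sr_mul_sr, out, Int.even_add, Int.even_sub] <;>
    by_cases hi : Even i <;> by_cases hj : Even j <;> simp [hi, hj]

theorem sec_mul (g h : Γ) (x : Bool) : sec (g * h) x = sec g (out h x) * sec h x := by
  rcases g with (i : ℤ) | (i : ℤ) <;> rcases h with (j : ℤ) | (j : ℤ) <;> cases x <;>
    simp only [r_mul_r, r_mul_sr, sr_mul_r, sr_mul_sr, out, sec, Int.even_add, Int.even_sub] <;>
    by_cases hi : Even i <;> by_cases hj : Even j <;>
    simp only [hi, hj, if_true, if_false, r_mul_r, r_mul_sr, sr_mul_r, sr_mul_sr, Bool.not_true,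
      Bool.not_false, r_inj, sr_inj, iff_true, iff_false, not_true] <;>
    grind


theorem out_injective (g : Γ) : Function.Injective (out g) := by
  intro x y h
  have := congrArg (out g⁻¹) h
  rwa [← out_mul, ← out_mul, inv_mul_cancel, out_one, out_one] at this

/-- An element is determined by its action on one letter and its section there
(pseudo-freeness). -/
theorem eq_of_out_sec {g h : Γ} {x : Bool} (ho : out g x = out h x) (hs : sec g x = sec h x) :
    g = h := by
  rcases g with (i : ℤ) | (i : ℤ) <;> rcases h with (j : ℤ) | (j : ℤ) <;> cases x <;>
    simp only [out, sec] at ho hs <;>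
    by_cases hi : Even i <;> by_cases hj : Even j <;>
    simp [hi, hj] at ho hs <;>
    simp only [r_inj, sr_inj] at hs ⊢ <;>
    grind

/-- The space `X^∞` of infinite words. -/
abbrev Cantor : Type := ℕ → Bool

/-- The infinite word `x z`. -/
def cons (x : Bool) (z : Cantor) : Cantor
  | 0 => x
  | n + 1 => z n

def tail (z : Cantor) : Cantor := fun n => z (n + 1)

/-- The infinite word `w z`. -/
def app : List Bool → Cantor → Cantor
  | [], z => z
  | x :: w, z => cons x (app w z)

/-- The infinite word obtained from `z` by deleting its first `n` letters. -/
def drop (n : ℕ) (z : Cantor) : Cantor := fun k => z (n + k)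

def take : ℕ → Cantor → List Bool
  | 0, _ => []
  | n + 1, z => z 0 :: take n (tail z)

/-- The cylinder set `Z(w)`. -/
def cyl (w : List Bool) : Set Cantor := Set.range (app w)

/-- The action of `Γ` on infinite words:
`g · x₁x₂… = y₁y₂…` with `y₁ = g · x₁` and `y₂y₃… = g|_{x₁} · x₂x₃…`. -/
def act (g : Γ) (z : Cantor) : Cantor
  | 0 => out g (z 0)
  | n + 1 => act (sec g (z 0)) (tail z) n

/-- The action of `Γ` on finite words. -/
def actW : Γ → List Bool → List Bool
  | _, [] => []
  | g, x :: w => out g x :: actW (sec g x) w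

/-- The section `g|_w` at a finite word. -/
def secW : Γ → List Bool → Γ
  | g, [] => g
  | g, x :: w => secW (sec g x) w

theorem cons_tail (z : Cantor) : cons (z 0) (tail z) = z := by
  funext n; cases n <;> rfl

theorem tail_cons (x : Bool) (z : Cantor) : tail (cons x z) = z := rfl

theorem cons_inj {x y : Bool} {z z' : Cantor} (h : cons x z = cons y z') : x = y ∧ z = z' :=
  ⟨congrFun h 0, congrArg tail h⟩

theorem act_cons (g : Γ) (x : Bool) (z : Cantor) :
    act g (cons x z) = cons (out g x) (act (sec g x) z) := by
  funext n
  cases n with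
  | zero => simp [act, cons]
  | succ n => simp only [act, cons]; rfl

theorem act_app (g : Γ) (w : List Bool) (z : Cantor) :
    act g (app w z) = app (actW g w) (act (secW g w) z) := by
  induction w generalizing g with
  | nil => rfl
  | cons x w ih => simp only [app, actW, secW, act_cons, ih]

theorem act_one (z : Cantor) : act 1 z = z := by
  funext n
  induction n generalizing z with
  | zero => simp [act, out_one]
  | succ n ih => simp only [act, sec_one, ih]; rfl

theorem act_mul (g h : Γ) (z : Cantor) : act (g * h) z = act g (act h z) := by
  funext n
  induction n generalizing g h z with
  | zero => simp [act, out_mul]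
  | succ n ih =>
    rw [← cons_tail z]
    simp only [act_cons, cons, sec_mul, ih]

theorem act_inv_act (g : Γ) (z : Cantor) : act g⁻¹ (act g z) = z := by
  rw [← act_mul, inv_mul_cancel, act_one]

theorem act_act_inv (g : Γ) (z : Cantor) : act g (act g⁻¹ z) = z := by
  rw [← act_mul, mul_inv_cancel, act_one]

theorem length_actW (g : Γ) (w : List Bool) : (actW g w).length = w.length := by
  induction w generalizing g with
  | nil => rfl
  | cons x w ih => simp [actW, ih]

theorem app_append (u v : List Bool) (z : Cantor) : app (u ++ v) z = app u (app v z) := by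
  induction u with
  | nil => rfl
  | cons x u ih => simp only [List.cons_append, app, ih]

theorem drop_app (w : List Bool) (z : Cantor) : drop w.length (app w z) = z := by
  induction w with
  | nil => funext k; simp [drop, app]
  | cons x w ih =>
    funext k
    have := congrFun ih k
    simp only [drop, List.length_cons, app] at this ⊢
    rw [show w.length + 1 + k = (w.length + k) + 1 by omega]
    exact this

theorem app_injective (w : List Bool) : Function.Injective (app w) := by
  intro z z' h
  rw [← drop_app w z, h, drop_app]

theorem length_take (n : ℕ) (z : Cantor) : (take n z).length = n := by
  induction n generalizing z with
  | zero => rfl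
  | succ n ih => simp [take, ih]

theorem app_take_drop (n : ℕ) (z : Cantor) : app (take n z) (drop n z) = z := by
  induction n generalizing z with
  | zero => funext k; simp [take, drop, app]
  | succ n ih =>
    have h : drop (n + 1) z = drop n (tail z) := by
      funext k; simp only [drop, tail]; congr 1; omega
    rw [take, app, h, ih, cons_tail]

theorem mem_cyl_take (n : ℕ) (z : Cantor) : z ∈ cyl (take n z) := ⟨_, app_take_drop n z⟩

/-- Two decompositions of an infinite word with prefixes of the same length agree. -/
theorem app_eq_app {u v : List Bool} {z z' : Cantor} (hl : u.length = v.length)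
    (h : app u z = app v z') : u = v ∧ z = z' := by
  induction u generalizing v with
  | nil =>
    obtain rfl : v = [] := List.length_eq_zero_iff.mp hl.symm
    exact ⟨rfl, h⟩
  | cons x u ih =>
    cases v with
    | nil => simp at hl
    | cons y v =>
      obtain ⟨rfl, h'⟩ := cons_inj h
      obtain ⟨rfl, h''⟩ := ih (by simpa using hl) h'
      exact ⟨rfl, h''⟩

/-- A longer prefix of a point of `Z(w)` extends `w`. -/
theorem exists_append {w v : List Bool} (hl : w.length ≤ v.length) {x : Cantor} (hw : x ∈ cyl w)
    (hv : x ∈ cyl v) : ∃ v', v = w ++ v' := by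
  obtain ⟨z, rfl⟩ := hw
  obtain ⟨z', hz'⟩ := hv
  rw [← List.take_append_drop w.length v, app_append] at hz'
  obtain ⟨h, -⟩ := app_eq_app (by simpa using hl) hz'
  refine ⟨v.drop w.length, ?_⟩
  conv_lhs => rw [← List.take_append_drop w.length v, h]

theorem continuous_cons (x : Bool) : Continuous (cons x) := by
  refine continuous_pi fun n => ?_
  cases n with
  | zero => exact continuous_const
  | succ n => exact continuous_apply n

theorem continuous_tail : Continuous tail := continuous_pi fun n => continuous_apply (n + 1)

theorem isOpenMap_cons (x : Bool) : IsOpenMap (cons x) := by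
  intro U hU
  have : cons x '' U = {z | z 0 = x} ∩ tail ⁻¹' U := by
    ext z
    constructor
    · rintro ⟨z, hz, rfl⟩
      exact ⟨rfl, hz⟩
    · rintro ⟨rfl, hz⟩
      exact ⟨_, hz, cons_tail z⟩
  rw [this]
  exact ((isOpen_discrete {x}).preimage (continuous_apply 0)).inter (hU.preimage continuous_tail)

theorem continuous_app (w : List Bool) : Continuous (app w) := by
  induction w with
  | nil => exact continuous_id
  | cons x w ih => exact (continuous_cons x).comp ih

theorem isOpenMap_app (w : List Bool) : IsOpenMap (app w) := by
  induction w with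
  | nil => exact IsOpenMap.id
  | cons x w ih => exact (isOpenMap_cons x).comp ih

theorem isOpen_cyl (w : List Bool) : IsOpen (cyl w) := (isOpenMap_app w).isOpen_range

theorem continuous_drop (n : ℕ) : Continuous (drop n) :=
  continuous_pi fun k => continuous_apply (n + k)

theorem continuous_act (g : Γ) : Continuous (act g) := by
  refine continuous_pi fun n => ?_
  induction n generalizing g with
  | zero => exact (continuous_of_discreteTopology (f := out g)).comp (continuous_apply 0)
  | succ n ih =>
    have h : Continuous fun p : Bool × Cantor => act (sec g p.1) p.2 n :=
      continuous_prod_of_discrete_left.mpr fun x => ih (sec g x)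
    exact h.comp ((continuous_apply 0).prodMk continuous_tail)

theorem isOpenMap_act (g : Γ) : IsOpenMap (act g) :=
  IsOpenMap.of_inverse (continuous_act g⁻¹) (act_act_inv g) (act_inv_act g)

theorem exists_cyl_subset {x : Cantor} {U : Set Cantor} (hU : U ∈ 𝓝 x) (m : ℕ) :
    ∃ n, m ≤ n ∧ cyl (take n x) ⊆ U := by
  have hd : ∀ n, ∀ (x z : Cantor), ∀ k < n, app (take n x) z k = x k := by
    intro n
    induction n with
    | zero => intro x z k hk; omega
    | succ n ih =>
      intro x z k hk
      cases k with
      | zero => rfl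
      | succ k => exact ih (tail x) z k (by omega)
  rw [nhds_pi, Filter.mem_pi] at hU
  obtain ⟨I, hI, t, ht, hts⟩ := hU
  obtain ⟨M, hM⟩ := hI.bddAbove
  refine ⟨max m (M + 1), le_max_left _ _, ?_⟩
  rintro _ ⟨z, rfl⟩
  refine hts fun k hk => ?_
  rw [hd _ _ _ _ (lt_of_lt_of_le (Nat.lt_succ_of_le (hM hk)) (le_max_right _ _))]
  exact mem_of_mem_nhds (ht k)

theorem out_and_act_sec {g : Γ} (H : ∀ z, act g z = z) (x : Bool) :
    out g x = x ∧ ∀ z, act (sec g x) z = z := by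
  refine ⟨?_, fun z => ?_⟩
  · have := H (cons x fun _ => x)
    rw [act_cons] at this
    exact (cons_inj this).1
  · have := H (cons x z)
    rw [act_cons] at this
    exact (cons_inj this).2

theorem eq_one_of_act_eq {g : Γ} (H : ∀ z, act g z = z) : g = 1 := by
  have h1 : ∀ i : ℤ, (∀ z, act (.sr i) z = z) → Odd i := fun i hi => by
    have := (out_and_act_sec hi false).1
    by_contra hne
    rw [Int.not_odd_iff_even] at hne
    simp [out, hne] at this
  have h2 : ∀ n : ℕ, ∀ i : ℤ, i.natAbs ≤ n → (∀ z, act (.r i) z = z) → i = 0 := by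
    intro n
    induction n with
    | zero => intro i hi _; omega
    | succ n ih =>
      intro i hi h
      have h3 := out_and_act_sec h true
      by_cases he : Even i
      · by_contra h0
        have h4 := h3.2
        simp only [sec, he, if_true] at h4
        obtain ⟨j, hj⟩ := he
        have := ih _ (by omega) h4
        omega
      · have := h3.1
        simp [out, he] at this
  rcases g with (i : ℤ) | (i : ℤ)
  · have h3 := h2 _ i le_rfl H
    subst h3
    rfl
  · exfalso
    have ho := h1 i H
    have he : ¬ Even i := Int.not_even_iff_odd.mpr ho
    have h3 := (out_and_act_sec H false).2
    have h4 := (out_and_act_sec H true).2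
    simp only [sec, he, if_false] at h3 h4
    have h5 := h1 _ h3
    have h6 := h1 _ h4
    grind

/-- Faithfulness of the action on infinite words. -/
theorem eq_of_act_eq {g h : Γ} (H : ∀ z, act g z = act h z) : g = h := by
  have : h⁻¹ * g = 1 := eq_one_of_act_eq fun z => by rw [act_mul, H, act_inv_act]
  exact (inv_mul_eq_one.mp this).symm

theorem length_le_of_app_act {u u' : List Bool} {k k' : Γ}
    (H : ∀ z, app u (act k z) = app u' (act k' z)) : u'.length ≤ u.length := by
  by_contra hlt
  push Not at hlt
  have hd : ∀ z, act k z = app (u'.drop u.length) (act k' z) := fun z => by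
    have h := H z
    rw [← List.take_append_drop u.length u', app_append] at h
    exact (app_eq_app (by simp; omega) h).2
  obtain ⟨x, v, hv⟩ : ∃ x v, u'.drop u.length = x :: v := by
    cases h : u'.drop u.length with
    | nil => simp at h; omega
    | cons x v => exact ⟨x, v, rfl⟩
  rw [hv] at hd
  have h0 : ∀ z : Cantor, out k (z 0) = x := fun z => congrFun (hd z) 0
  have := out_injective k ((h0 fun _ => true).trans (h0 fun _ => false).symm)
  exact absurd this (by decide)

theorem eq_of_actW_secW {g h : Γ} {w : List Bool} (ha : actW g w = actW h w)
    (hs : secW g w = secW h w) : g = h := by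
  induction w generalizing g h with
  | nil => exact hs
  | cons x w ih =>
    simp only [actW, List.cons.injEq] at ha
    exact eq_of_out_sec ha.1 (ih ha.2 hs)

/-- Two local self-similarities that agree on a cylinder set are equal. -/
theorem rigid {u u' w : List Bool} {k k' : Γ}
    (H : ∀ z ∈ cyl w, app u (act k z) = app u' (act k' z)) : u = u' ∧ k = k' := by
  have H' : ∀ z, app (u ++ actW k w) (act (secW k w) z) =
      app (u' ++ actW k' w) (act (secW k' w) z) := fun z => by
    rw [app_append, app_append, ← act_app, ← act_app]
    exact H _ ⟨z, rfl⟩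
  have hl : (u ++ actW k w).length = (u' ++ actW k' w).length :=
    le_antisymm (length_le_of_app_act fun z => (H' z).symm) (length_le_of_app_act H')
  have h1 : u ++ actW k w = u' ++ actW k' w := (app_eq_app hl (H' fun _ => true)).1
  have h2 : secW k w = secW k' w := eq_of_act_eq fun z => (app_eq_app hl (H' z)).2
  simp only [List.length_append, length_actW] at hl
  obtain ⟨h3, h4⟩ := List.append_inj h1 (by omega)
  exact ⟨h3, eq_of_actW_secW h4 h2⟩

end SelfSimilarDihedral

namespace SelfSimilarDihedral

/-- The data `(α, g, β)` of a local homeomorphism `S_(α,g,β) : Z(β) → Z(α)`. -/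
structure Triple where
  α : List Bool
  g : Γ
  β : List Bool

namespace Triple

/-- The map `S_(α,g,β)`, `β x ↦ α (g · x)`. Only its values on `Z(β)` matter. -/
def S (i : Triple) (y : Cantor) : Cantor := app i.α (act i.g (drop i.β.length y))

theorem S_app (i : Triple) (z : Cantor) : i.S (app i.β z) = app i.α (act i.g z) := by
  rw [S, drop_app]

theorem continuous_S (i : Triple) : Continuous i.S :=
  (continuous_app _).comp ((continuous_act _).comp (continuous_drop _))

theorem S_mem (i : Triple) (y : Cantor) : i.S y ∈ cyl i.α := ⟨_, rfl⟩

theorem injOn_S (i : Triple) : Set.InjOn i.S (cyl i.β) := by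
  rintro _ ⟨z, rfl⟩ _ ⟨z', rfl⟩ h
  rw [S_app, S_app] at h
  have := congrArg (act i.g⁻¹) (app_injective _ h)
  rw [act_inv_act, act_inv_act] at this
  rw [this]

theorem isOpen_image_S (i : Triple) {U : Set Cantor} (hU : IsOpen U) :
    IsOpen (i.S '' (U ∩ cyl i.β)) := by
  have : i.S '' (U ∩ cyl i.β) = app i.α '' (act i.g '' (app i.β ⁻¹' U)) := by
    ext y
    constructor
    · rintro ⟨_, ⟨h, z, rfl⟩, rfl⟩
      exact ⟨_, ⟨z, h, rfl⟩, (i.S_app z).symm⟩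
    · rintro ⟨_, ⟨z, h, rfl⟩, rfl⟩
      exact ⟨_, ⟨h, z, rfl⟩, i.S_app z⟩
  rw [this]
  exact isOpenMap_app _ _ (isOpenMap_act _ _ (hU.preimage (continuous_app _)))

/-- The identity `S_(∅,e,∅)`. -/
def unit : Triple := ⟨[], 1, []⟩

theorem unit_S (y : Cantor) : unit.S y = y := by
  have := unit.S_app y
  simpa [unit, app, act_one] using this

theorem mem_unit (y : Cantor) : y ∈ cyl unit.β := ⟨y, rfl⟩

def symm (i : Triple) : Triple := ⟨i.β, i.g⁻¹, i.α⟩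

theorem S_mem_symm (i : Triple) (y : Cantor) : i.S y ∈ cyl i.symm.β := i.S_mem y

theorem symm_S_S (i : Triple) {y : Cantor} (hy : y ∈ cyl i.β) : i.symm.S (i.S y) = y := by
  obtain ⟨z, rfl⟩ := hy
  rw [S_app]
  have := i.symm.S_app (act i.g z)
  simpa [symm, act_inv_act] using this

theorem S_symm_S (i : Triple) {y : Cantor} (hy : y ∈ cyl i.α) : i.S (i.symm.S y) = y := by
  obtain ⟨z, rfl⟩ := hy
  have h : i.symm.S (app i.α z) = app i.β (act i.g⁻¹ z) := i.symm.S_app z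
  rw [h, S_app, act_act_inv]

/-- The restriction `(α (g · γ), g|_γ, β γ)` of `(α, g, β)` to `Z(βγ)`. -/
def ext (i : Triple) (γ : List Bool) : Triple := ⟨i.α ++ actW i.g γ, secW i.g γ, i.β ++ γ⟩

theorem ext_S (i : Triple) (γ : List Bool) {y : Cantor} (hy : y ∈ cyl (i.β ++ γ)) :
    (i.ext γ).S y = i.S y := by
  obtain ⟨z, rfl⟩ := hy
  have h1 := (i.ext γ).S_app z
  have h2 := i.S_app (app γ z)
  rw [← app_append] at h2
  rw [h2, act_app, ← app_append]
  exact h1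

/-- Every `(α, g, β)` can be restricted to a smaller cylinder set around a point of `Z(β)`. -/
theorem exists_ext (i : Triple) {x : Cantor} (hx : x ∈ cyl i.β) {n : ℕ} (hn : i.β.length ≤ n) :
    ∃ j : Triple, j.β = take n x ∧ (j.α.length : ℤ) - j.β.length = i.α.length - i.β.length ∧
      ∀ y ∈ cyl j.β, j.S y = i.S y := by
  obtain ⟨γ, hγ⟩ := exists_append (hn.trans (length_take n x).ge) hx (mem_cyl_take n x)
  refine ⟨i.ext γ, hγ.symm, ?_, fun y hy => i.ext_S γ hy⟩
  simp [ext, length_actW]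

theorem cyl_take_subset (i : Triple) {x : Cantor} (hx : x ∈ cyl i.β) {n : ℕ}
    (hn : i.β.length ≤ n) : cyl (take n x) ⊆ cyl i.β := by
  obtain ⟨γ, hγ⟩ := exists_append (hn.trans (length_take n x).ge) hx (mem_cyl_take n x)
  rintro _ ⟨z, rfl⟩
  rw [hγ, app_append]
  exact ⟨_, rfl⟩

/-- If `S_i` and `S_j` coincide at all points of some open set, they coincide on every cylinder
set, meeting it, on which both are defined. -/
theorem eqOn_of_germ_eq {i j : Triple} {x y : Cantor} {n : ℕ} (hix : x ∈ cyl i.β)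
    (hjx : x ∈ cyl j.β) (hin : i.β.length ≤ n) (hjn : j.β.length ≤ n) (hy : y ∈ cyl (take n x))
    (h : i.S =ᶠ[𝓝 y] j.S) :
    (∀ z ∈ cyl (take n x), i.S z = j.S z) ∧
      (i.α.length : ℤ) - i.β.length = j.α.length - j.β.length := by
  obtain ⟨i', hi1, hi2, hi3⟩ := i.exists_ext hix hin
  obtain ⟨j', hj1, hj2, hj3⟩ := j.exists_ext hjx hjn
  have hm : {z | i.S z = j.S z} ∈ 𝓝 y := h
  obtain ⟨m, hnm, hm⟩ := exists_cyl_subset hm n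
  obtain ⟨w, hw⟩ := exists_append (by rw [length_take, length_take]; exact hnm) hy
    (mem_cyl_take m y)
  have key : ∀ z ∈ cyl w, app i'.α (act i'.g z) = app j'.α (act j'.g z) := by
    rintro _ ⟨z, rfl⟩
    rw [← S_app, ← S_app, hi1, hj1, hi3 _ (hi1 ▸ ⟨_, rfl⟩), hj3 _ (hj1 ▸ ⟨_, rfl⟩)]
    apply hm
    rw [hw]
    exact ⟨z, app_append _ _ _⟩
  obtain ⟨h1, h2⟩ := rigid key
  have h3 : i' = j' := by
    cases i'; cases j'
    simp_all
  subst h3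
  refine ⟨fun z hz => ?_, by omega⟩
  rw [← hi3 z (hi1 ▸ hz), hj3 z (hi1 ▸ hz)]

/-- The product formula: around `x` the composite `S_i ∘ S_j` is again of the form `S_k`. -/
theorem exists_comp (i j : Triple) {x : Cantor} (hx : x ∈ cyl j.β) (hy : j.S x ∈ cyl i.β) :
    ∃ k : Triple, x ∈ cyl k.β ∧ k.S =ᶠ[𝓝 x] i.S ∘ j.S ∧
      (k.α.length : ℤ) - k.β.length =
        (i.α.length - i.β.length) + (j.α.length - j.β.length) ∧
      (i.β.length = j.α.length → k.α.length = i.α.length ∧ k.β.length = j.β.length) := by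
  set M := max i.β.length j.α.length with hM
  obtain ⟨i', hi1, hi2, hi3⟩ := i.exists_ext hy (le_max_left _ _ : i.β.length ≤ M)
  obtain ⟨j', hj1, hj2, hj3⟩ :=
    j.exists_ext hx (Nat.le_add_right _ (M - j.α.length) : j.β.length ≤ _)
  have hjl : j'.β.length = j.β.length + (M - j.α.length) := by rw [hj1, length_take]
  have hil : i'.β.length = M := by rw [hi1, length_take]
  have hMj : j.α.length ≤ M := le_max_right _ _
  have hxj : x ∈ cyl j'.β := hj1 ▸ mem_cyl_take _ _
  have hβα : i'.β = j'.α := by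
    obtain ⟨z, hz⟩ := j'.S_mem x
    obtain ⟨z', hz'⟩ : j.S x ∈ cyl i'.β := hi1 ▸ mem_cyl_take _ _
    rw [hj3 x hxj] at hz
    exact (app_eq_app (by omega) (hz'.trans hz.symm)).1
  refine ⟨⟨i'.α, i'.g * j'.g, j'.β⟩, hxj, ?_, ?_, ?_⟩
  · filter_upwards [(isOpen_cyl j'.β).mem_nhds hxj] with y hyj
    have h1 := hj3 y hyj
    obtain ⟨z, rfl⟩ := hyj
    rw [S_app] at h1
    have h2 := (⟨i'.α, i'.g * j'.g, j'.β⟩ : Triple).S_app z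
    simp only at h2
    rw [h2, act_mul, Function.comp, ← h1, ← hβα, ← hi3 _ ⟨_, rfl⟩, S_app]
  · have : (j'.α.length : ℤ) = i'.β.length := by rw [hβα]
    simp only
    omega
  · intro h
    simp only
    omega

end Triple

open Filter

/-- The groupoid of germs of the local homeomorphisms `S_(α,g,β)`: an arrow is a germ at a
point `src` of a map `S_(α,g,β)` with `src ∈ Z(β)`. -/
@[ext]
structure GermArr where
  src : Cantor
  germ : Germ (𝓝 src) Cantor
  isGerm : ∃ i : Triple, src ∈ cyl i.β ∧ germ = (i.S : Germ (𝓝 src) Cantor)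

namespace GermArr

/-- The germ `[α, g, β; x]`, for `x ∈ Z(β)`. -/
def ofTriple (i : Triple) (x : Cantor) (hx : x ∈ cyl i.β) : GermArr := ⟨x, i.S, i, hx, rfl⟩

theorem exists_ofTriple (γ : GermArr) : ∃ i x hx, γ = ofTriple i x hx := by
  obtain ⟨x, _, i, hx, rfl⟩ := γ
  exact ⟨i, x, hx, rfl⟩

theorem ofTriple_eq_iff {i j : Triple} {x y : Cantor} {hx : x ∈ cyl i.β} {hy : y ∈ cyl j.β} :
    ofTriple i x hx = ofTriple j y hy ↔ x = y ∧ i.S =ᶠ[𝓝 x] j.S := by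
  constructor
  · intro h
    obtain rfl : x = y := congrArg src h
    refine ⟨rfl, ?_⟩
    simp only [ofTriple, GermArr.mk.injEq, heq_eq_eq, true_and] at h
    exact Germ.coe_eq.mp h
  · rintro ⟨rfl, h⟩
    simp only [ofTriple, GermArr.mk.injEq, heq_eq_eq, true_and]
    exact Germ.coe_eq.mpr h

/-- The range of a germ is its value at the source. -/
def rng (γ : GermArr) : Cantor := γ.germ.value

theorem rng_ofTriple (i : Triple) (x : Cantor) (hx : x ∈ cyl i.β) : (ofTriple i x hx).rng = i.S x := rfl

theorem tendsto (γ : GermArr) : γ.germ.Tendsto (𝓝 γ.rng) := by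
  obtain ⟨i, x, hx, rfl⟩ := γ.exists_ofTriple
  exact i.continuous_S.continuousAt

/-- The unit at `x`, the germ of the identity. -/
def one (x : Cantor) : GermArr where
  src := x
  germ := ((fun y => y : Cantor → Cantor) : Germ (𝓝 x) Cantor)
  isGerm := ⟨Triple.unit, Triple.mem_unit x, by
    congr 1; exact funext fun y => (Triple.unit_S y).symm⟩

theorem one_eq (x : Cantor) : one x = ofTriple Triple.unit x (Triple.mem_unit x) := by
  simp only [one, ofTriple, GermArr.mk.injEq, heq_eq_eq, true_and]
  congr 1; exact funext fun y => (Triple.unit_S y).symm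

/-- The product: the germ of the composite. -/
def mul (γ δ : GermArr) (e : γ.src = δ.rng) : GermArr where
  src := δ.src
  germ := γ.germ.compTendsto' δ.germ (e ▸ δ.tendsto)
  isGerm := by
    obtain ⟨i, y, hy, rfl⟩ := γ.exists_ofTriple
    obtain ⟨j, x, hx, rfl⟩ := δ.exists_ofTriple
    obtain rfl : y = j.S x := e
    obtain ⟨k, hk, h, -⟩ := i.exists_comp j hx hy
    exact ⟨k, hk, Germ.coe_eq.mpr h.symm⟩

theorem mul_ofTriple {i j k : Triple} {y x : Cantor} (hy : y ∈ cyl i.β) (hx : x ∈ cyl j.β)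
    (e : y = j.S x) (hk : x ∈ cyl k.β) (h : k.S =ᶠ[𝓝 x] i.S ∘ j.S) :
    mul (ofTriple i y hy) (ofTriple j x hx) e = ofTriple k x hk := by
  subst e
  simp only [mul, ofTriple, GermArr.mk.injEq, heq_eq_eq, true_and]
  exact Germ.coe_eq.mpr h.symm

/-- The inverse: the germ at `rng γ` of the inverse map `S_(β,g⁻¹,α)`. -/
noncomputable def inv (γ : GermArr) : GermArr :=
  ofTriple γ.isGerm.choose.symm γ.rng (by
    have h := γ.isGerm.choose_spec.2
    have : γ.rng = γ.isGerm.choose.S γ.src := (congrArg Germ.value h)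
    rw [this]
    exact Triple.S_mem _ _)

theorem inv_ofTriple (i : Triple) (x : Cantor) (hx : x ∈ cyl i.β) :
    inv (ofTriple i x hx) = ofTriple i.symm (i.S x) (i.S_mem_symm x) := by
  have hex := (ofTriple i x hx).isGerm
  have h1 : x ∈ cyl hex.choose.β := hex.choose_spec.1
  have h2 : i.S =ᶠ[𝓝 x] hex.choose.S := Germ.coe_eq.mp hex.choose_spec.2
  show ofTriple hex.choose.symm (i.S x) _ = _
  refine ofTriple_eq_iff.mpr ⟨rfl, ?_⟩
  obtain ⟨V, hV, hVo, hxV⟩ := mem_nhds_iff.mp h2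
  have hW := i.isOpen_image_S (hVo.inter (isOpen_cyl hex.choose.β))
  filter_upwards [hW.mem_nhds ⟨x, ⟨⟨hxV, h1⟩, hx⟩, rfl⟩]
  rintro _ ⟨v, ⟨⟨hvV, hv1⟩, hvi⟩, rfl⟩
  rw [i.symm_S_S hvi]
  have h3 : i.S v = hex.choose.S v := hV hvV
  rw [h3, Triple.symm_S_S _ hv1]

/-- The basic open set `Z(α,g,β;U)` of germs of `S_(α,g,β)` at points of `U ∩ Z(β)`. -/
def basic (i : Triple) (U : Set Cantor) : Set GermArr :=
  {γ | ∃ x, ∃ hx : x ∈ cyl i.β, x ∈ U ∧ γ = ofTriple i x hx}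

instance : TopologicalSpace GermArr :=
  TopologicalSpace.generateFrom {s | ∃ i U, IsOpen U ∧ s = basic i U}

theorem isTopologicalBasis :
    TopologicalSpace.IsTopologicalBasis {s | ∃ i U, IsOpen U ∧ s = basic i U} where
  exists_subset_inter := by
    rintro _ ⟨i, U, hU, rfl⟩ _ ⟨j, V, hV, rfl⟩ γ ⟨⟨x, hx, hxU, rfl⟩, ⟨y, hy, hyV, h⟩⟩
    obtain ⟨rfl, hS⟩ := ofTriple_eq_iff.mp h
    obtain ⟨W, hW, hWo, hxW⟩ := mem_nhds_iff.mp hS.eventuallyEq_nhds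
    refine ⟨_, ⟨i, U ∩ V ∩ cyl j.β ∩ W, ((hU.inter hV).inter (isOpen_cyl _)).inter hWo, rfl⟩,
      ⟨x, hx, ⟨⟨⟨hxU, hyV⟩, hy⟩, hxW⟩, rfl⟩, ?_⟩
    rintro _ ⟨z, hz, ⟨⟨⟨hzU, hzV⟩, hzj⟩, hzW⟩, rfl⟩
    exact ⟨⟨z, hz, hzU, rfl⟩, ⟨z, hzj, hzV, ofTriple_eq_iff.mpr ⟨rfl, hW hzW⟩⟩⟩
  sUnion_eq := by
    refine Set.eq_univ_of_forall fun γ => ?_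
    obtain ⟨i, x, hx, rfl⟩ := γ.exists_ofTriple
    exact ⟨_, ⟨i, Set.univ, isOpen_univ, rfl⟩, x, hx, trivial, rfl⟩
  eq_generateFrom := rfl

theorem isOpen_basic (i : Triple) {U : Set Cantor} (hU : IsOpen U) : IsOpen (basic i U) :=
  isTopologicalBasis.isOpen ⟨i, U, hU, rfl⟩

theorem continuous_src : Continuous src := by
  refine continuous_def.mpr fun U hU => isOpen_iff_forall_mem_open.mpr fun γ hγ => ?_
  obtain ⟨i, x, hx, rfl⟩ := γ.exists_ofTriple
  refine ⟨basic i U, ?_, isOpen_basic i hU, x, hx, hγ, rfl⟩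
  rintro _ ⟨y, hy, hyU, rfl⟩
  exact hyU

theorem continuous_rng : Continuous rng := by
  refine continuous_def.mpr fun U hU => isOpen_iff_forall_mem_open.mpr fun γ hγ => ?_
  obtain ⟨i, x, hx, rfl⟩ := γ.exists_ofTriple
  refine ⟨basic i (i.S ⁻¹' U), ?_, isOpen_basic i (hU.preimage i.continuous_S), x, hx, hγ, rfl⟩
  rintro _ ⟨y, hy, hyU, rfl⟩
  exact hyU

theorem isLocalHomeomorph_src : IsLocalHomeomorph src := by
  refine isLocalHomeomorph_of_isOpenMap continuous_src ?_ fun γ => ?_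
  · rw [isTopologicalBasis.isOpenMap_iff]
    rintro _ ⟨i, U, hU, rfl⟩
    have : src '' basic i U = U ∩ cyl i.β := by
      ext x
      constructor
      · rintro ⟨_, ⟨y, hy, hyU, rfl⟩, rfl⟩
        exact ⟨hyU, hy⟩
      · rintro ⟨hxU, hx⟩
        exact ⟨_, ⟨x, hx, hxU, rfl⟩, rfl⟩
    rw [this]
    exact hU.inter (isOpen_cyl _)
  · obtain ⟨i, x, hx, rfl⟩ := γ.exists_ofTriple
    refine ⟨basic i Set.univ, isOpen_basic i isOpen_univ, ⟨x, hx, trivial, rfl⟩, ?_⟩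
    rintro _ ⟨y, hy, -, rfl⟩ _ ⟨z, hz, -, rfl⟩ h
    obtain rfl : y = z := h
    rfl

theorem isLocalHomeomorph_rng : IsLocalHomeomorph rng := by
  refine isLocalHomeomorph_of_isOpenMap continuous_rng ?_ fun γ => ?_
  · rw [isTopologicalBasis.isOpenMap_iff]
    rintro _ ⟨i, U, hU, rfl⟩
    have : rng '' basic i U = i.S '' (U ∩ cyl i.β) := by
      ext x
      constructor
      · rintro ⟨_, ⟨y, hy, hyU, rfl⟩, rfl⟩
        exact ⟨y, ⟨hyU, hy⟩, rfl⟩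
      · rintro ⟨y, ⟨hyU, hy⟩, rfl⟩
        exact ⟨_, ⟨y, hy, hyU, rfl⟩, rfl⟩
    rw [this]
    exact i.isOpen_image_S hU
  · obtain ⟨i, x, hx, rfl⟩ := γ.exists_ofTriple
    refine ⟨basic i Set.univ, isOpen_basic i isOpen_univ, ⟨x, hx, trivial, rfl⟩, ?_⟩
    rintro _ ⟨y, hy, -, rfl⟩ _ ⟨z, hz, -, rfl⟩ h
    obtain rfl : y = z := i.injOn_S hy hz h
    rfl

theorem continuous_one : Continuous one := by
  refine continuous_generateFrom_iff.mpr ?_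
  rintro _ ⟨i, U, hU, rfl⟩
  refine isOpen_iff_mem_nhds.mpr ?_
  rintro x ⟨y, hy, hyU, h⟩
  rw [one_eq] at h
  obtain ⟨rfl, hS⟩ := ofTriple_eq_iff.mp h
  filter_upwards [hS.eventuallyEq_nhds, hU.mem_nhds hyU, (isOpen_cyl i.β).mem_nhds hy]
    with z hz hzU hzi
  exact ⟨z, hzi, hzU, by rw [one_eq]; exact ofTriple_eq_iff.mpr ⟨rfl, hz⟩⟩

theorem continuous_inv : Continuous inv := by
  refine continuous_generateFrom_iff.mpr ?_
  rintro _ ⟨j, U, hU, rfl⟩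
  refine isOpen_iff_forall_mem_open.mpr ?_
  rintro γ ⟨y, hy, hyU, h⟩
  obtain ⟨i, x, hx, rfl⟩ := γ.exists_ofTriple
  rw [inv_ofTriple] at h
  obtain ⟨rfl, hS⟩ := ofTriple_eq_iff.mp h
  obtain ⟨W, hW, hWo, hxW⟩ := mem_nhds_iff.mp
    (hS.eventuallyEq_nhds.and (((isOpen_cyl j.β).inter hU).mem_nhds ⟨hy, hyU⟩))
  refine ⟨basic i (i.S ⁻¹' W), ?_, isOpen_basic i (hWo.preimage i.continuous_S),
    x, hx, hxW, rfl⟩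
  rintro _ ⟨z, hz, hzW, rfl⟩
  obtain ⟨h1, h2, h3⟩ := hW hzW
  exact ⟨i.S z, h2, h3, by rw [inv_ofTriple]; exact ofTriple_eq_iff.mpr ⟨rfl, h1⟩⟩

theorem continuous_mul : Continuous fun p : {p : GermArr × GermArr // p.1.src = p.2.rng} =>
    mul p.1.1 p.1.2 p.2 := by
  refine continuous_generateFrom_iff.mpr ?_
  rintro _ ⟨k, U, hU, rfl⟩
  refine isOpen_iff_forall_mem_open.mpr ?_
  rintro ⟨⟨γ, δ⟩, e⟩ ⟨w, hw, hwU, h⟩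
  obtain ⟨i, y, hy, rfl⟩ := γ.exists_ofTriple
  obtain ⟨j, x, hx, rfl⟩ := δ.exists_ofTriple
  obtain rfl : y = j.S x := e
  obtain rfl : x = w := congrArg src h
  obtain ⟨l, hl, hS, -⟩ := i.exists_comp j hx hy
  have h' := h
  simp only [mul_ofTriple hy hx rfl hl hS] at h'
  have hkS : k.S =ᶠ[𝓝 x] i.S ∘ j.S := (ofTriple_eq_iff.mp h').2.symm.trans hS
  obtain ⟨W, hW, hWo, hxW⟩ := mem_nhds_iff.mp
    (hkS.eventuallyEq_nhds.and (((isOpen_cyl k.β).inter hU).mem_nhds ⟨hw, hwU⟩))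
  refine ⟨{p | p.1.1 ∈ basic i Set.univ ∧ p.1.2 ∈ basic j W}, ?_, ?_,
    ⟨_, hy, trivial, rfl⟩, ⟨_, hx, hxW, rfl⟩⟩
  · rintro ⟨⟨_, _⟩, e'⟩ ⟨⟨y', hy', -, rfl⟩, ⟨x', hx', hx'W, rfl⟩⟩
    obtain ⟨h1, h2, h3⟩ := hW hx'W
    exact ⟨x', h2, h3, mul_ofTriple hy' hx' e' h2 h1⟩
  · exact ((isOpen_basic i isOpen_univ).preimage (by fun_prop)).inter
      ((isOpen_basic j hWo).preimage (by fun_prop))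

instance : T2Space GermArr where
  t2 := by
    intro γ δ hne
    by_cases hs : γ.src = δ.src
    · obtain ⟨i, x, hx, rfl⟩ := γ.exists_ofTriple
      obtain ⟨j, y, hy, rfl⟩ := δ.exists_ofTriple
      obtain rfl : x = y := hs
      set n := max i.β.length j.β.length
      have hc := mem_cyl_take n x
      refine ⟨_, _, isOpen_basic i (isOpen_cyl (take n x)), isOpen_basic j (isOpen_cyl (take n x)),
        ⟨x, hx, hc, rfl⟩, ⟨x, hy, hc, rfl⟩, Set.disjoint_left.mpr ?_⟩
      rintro _ ⟨z, hz, hzc, rfl⟩ ⟨z', hz', -, h⟩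
      obtain ⟨rfl, hS⟩ := ofTriple_eq_iff.mp h
      have := (Triple.eqOn_of_germ_eq hx hy (le_max_left _ _) (le_max_right _ _) hzc hS).1
      exact hne (ofTriple_eq_iff.mpr ⟨rfl,
        Filter.eventually_of_mem ((isOpen_cyl _).mem_nhds hc) this⟩)
    · exact separated_by_continuous continuous_src hs

/-- The canonical cocycle `c([α, g, β; x]) = |α| - |β|`. -/
noncomputable def c (γ : GermArr) : ℤ :=
  (γ.isGerm.choose.α.length : ℤ) - γ.isGerm.choose.β.length

/-- The cocycle does not depend on the representative of the germ. -/
theorem c_ofTriple (i : Triple) (x : Cantor) (hx : x ∈ cyl i.β) :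
    c (ofTriple i x hx) = i.α.length - i.β.length := by
  have hex := (ofTriple i x hx).isGerm
  have h1 : x ∈ cyl hex.choose.β := hex.choose_spec.1
  have h2 : i.S =ᶠ[𝓝 x] hex.choose.S := Germ.coe_eq.mp hex.choose_spec.2
  exact (Triple.eqOn_of_germ_eq hx h1 (le_max_left _ _) (le_max_right _ _)
    (mem_cyl_take _ x) h2).2.symm

theorem c_one (x : Cantor) : c (one x) = 0 := by
  rw [one_eq, c_ofTriple]
  simp [Triple.unit]

theorem c_inv (γ : GermArr) : c (inv γ) = -c γ := by
  obtain ⟨i, x, hx, rfl⟩ := γ.exists_ofTriple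
  rw [inv_ofTriple, c_ofTriple, c_ofTriple]
  simp [Triple.symm]

theorem c_mul (γ δ : GermArr) (e : γ.src = δ.rng) : c (mul γ δ e) = c γ + c δ := by
  obtain ⟨i, y, hy, rfl⟩ := γ.exists_ofTriple
  obtain ⟨j, x, hx, rfl⟩ := δ.exists_ofTriple
  obtain rfl : y = j.S x := e
  obtain ⟨k, hk, hS, hc, -⟩ := i.exists_comp j hx hy
  rw [mul_ofTriple hy hx rfl hk hS, c_ofTriple, c_ofTriple, c_ofTriple, hc]

theorem mul_assoc (γ δ ε : GermArr) (e₁ : γ.src = δ.rng) (e₂ : δ.src = ε.rng)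
    (e₃ : γ.src = (mul δ ε e₂).rng) : mul (mul γ δ e₁) ε e₂ = mul γ (mul δ ε e₂) e₃ := by
  obtain ⟨i, y, hy, rfl⟩ := γ.exists_ofTriple
  obtain ⟨j, x, hx, rfl⟩ := δ.exists_ofTriple
  obtain ⟨k, w, hw, rfl⟩ := ε.exists_ofTriple
  obtain rfl : y = j.S x := e₁
  obtain rfl : x = k.S w := e₂
  rfl

end GermArr

open GermArr in
/-- The groupoid of germs `G_(Γ,X)` of the self-similar infinite dihedral group. -/
noncomputable def G : EtaleGroupoid where
  Ob := Cantor
  Arr := GermArr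
  src := src
  rng := rng
  one := one
  inv := inv
  mul := mul
  src_one _ := rfl
  rng_one _ := rfl
  src_inv _ := rfl
  rng_inv γ := by
    obtain ⟨i, x, hx, rfl⟩ := γ.exists_ofTriple
    rw [inv_ofTriple, rng_ofTriple, i.symm_S_S hx]
    rfl
  src_mul _ _ _ := rfl
  rng_mul γ δ e := by
    obtain ⟨i, y, hy, rfl⟩ := γ.exists_ofTriple
    obtain ⟨j, x, hx, rfl⟩ := δ.exists_ofTriple
    obtain rfl : y = j.S x := e
    rfl
  one_mul γ := by
    obtain ⟨i, x, hx, rfl⟩ := γ.exists_ofTriple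
    rfl
  mul_one γ := by
    obtain ⟨i, x, hx, rfl⟩ := γ.exists_ofTriple
    rfl
  mul_assoc γ δ ε e₁ e₂ := GermArr.mul_assoc γ δ ε e₁ e₂ _
  inv_mul γ := by
    obtain ⟨i, x, hx, rfl⟩ := γ.exists_ofTriple
    have key : ∀ δ (hδ : δ = ofTriple i.symm (i.S x) (i.S_mem_symm x))
        (e : δ.src = (ofTriple i x hx).rng), mul δ (ofTriple i x hx) e = one x := by
      rintro _ rfl e
      rw [one_eq]
      refine mul_ofTriple _ hx rfl (Triple.mem_unit x) ?_
      filter_upwards [(isOpen_cyl i.β).mem_nhds hx] with y hy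
      rw [Triple.unit_S, Function.comp, i.symm_S_S hy]
    exact key _ (inv_ofTriple i x hx) _
  mul_inv γ := by
    obtain ⟨i, x, hx, rfl⟩ := γ.exists_ofTriple
    have key : ∀ δ (hδ : δ = ofTriple i.symm (i.S x) (i.S_mem_symm x))
        (e : (ofTriple i x hx).src = δ.rng), mul (ofTriple i x hx) δ e = one (i.S x) := by
      rintro _ rfl e
      rw [one_eq]
      refine mul_ofTriple hx _ e (Triple.mem_unit _) ?_
      filter_upwards [(isOpen_cyl i.α).mem_nhds (i.S_mem x)] with y hy
      rw [Triple.unit_S, Function.comp, i.S_symm_S hy]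
    exact key _ (inv_ofTriple i x hx) _
  continuous_one := continuous_one
  continuous_inv := continuous_inv
  continuous_mul := continuous_mul
  isLocalHomeomorph_src := isLocalHomeomorph_src
  isLocalHomeomorph_rng := isLocalHomeomorph_rng

open GermArr

/-- The kernel `H = c⁻¹(0)` of the canonical cocycle, as an open subgroupoid of `G`. -/
def kernel : EtaleGroupoid.OpenSubgroupoid G where
  carrier := {γ : GermArr | c γ = 0}
  isOpen_carrier := by
    refine isOpen_iff_forall_mem_open.mpr fun γ (hγ : c γ = 0) => ?_
    obtain ⟨i, x, hx, rfl⟩ := GermArr.exists_ofTriple γ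
    refine ⟨basic i Set.univ, ?_, isOpen_basic i isOpen_univ, x, hx, trivial, rfl⟩
    rintro _ ⟨y, hy, -, rfl⟩
    show c _ = 0
    rw [c_ofTriple] at hγ ⊢
    exact hγ
  one_mem x := c_one x
  inv_mem γ (hγ : c γ = 0) := (c_inv γ).trans (neg_eq_zero.mpr hγ)
  mul_mem γ δ e (hγ : c γ = 0) (hδ : c δ = 0) :=
    (c_mul γ δ e).trans (by rw [hγ, hδ, add_zero])

/-- The open subgroupoid `H_n = {[α, g, β; x] : |α| = |β| = n}`. -/
def level (n : ℕ) : EtaleGroupoid.OpenSubgroupoid G where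
  carrier := {γ : GermArr | ∃ i x hx, i.α.length = n ∧ i.β.length = n ∧ γ = ofTriple i x hx}
  isOpen_carrier := by
    refine isOpen_iff_forall_mem_open.mpr ?_
    rintro _ ⟨i, x, hx, hα, hβ, rfl⟩
    refine ⟨basic i Set.univ, ?_, isOpen_basic i isOpen_univ, x, hx, trivial, rfl⟩
    rintro _ ⟨y, hy, -, rfl⟩
    exact ⟨i, y, hy, hα, hβ, rfl⟩
  one_mem x := by
    refine ⟨⟨take n x, 1, take n x⟩, x, mem_cyl_take n x, length_take n x, length_take n x, ?_⟩
    refine (one_eq x).trans (ofTriple_eq_iff.mpr ⟨rfl, ?_⟩)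
    filter_upwards [(isOpen_cyl _).mem_nhds (mem_cyl_take n x)]
    rintro _ ⟨z, rfl⟩
    have := (⟨take n x, 1, take n x⟩ : Triple).S_app z
    rw [Triple.unit_S, this, act_one]
  inv_mem := by
    rintro _ ⟨i, x, hx, hα, hβ, rfl⟩
    exact ⟨i.symm, i.S x, i.S_mem_symm x, hβ, hα, inv_ofTriple i x hx⟩
  mul_mem := by
    rintro _ _ e ⟨i, y, hy, hα, hβ, rfl⟩ ⟨j, x, hx, hα', hβ', rfl⟩
    obtain rfl : y = j.S x := e
    obtain ⟨k, hk, hS, -, hl⟩ := i.exists_comp j hx hy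
    obtain ⟨h1, h2⟩ := hl (hβ.trans hα'.symm)
    exact ⟨k, x, hk, h1.trans hα, h2.trans hβ', mul_ofTriple hy hx rfl hk hS⟩

theorem level_mono {n m : ℕ} (h : n ≤ m) : (level n).carrier ⊆ (level m).carrier := by
  rintro _ ⟨i, x, hx, hα, hβ, rfl⟩
  obtain ⟨j, h1, h2, h3⟩ := i.exists_ext hx (hβ.trans_le h)
  have hl : j.β.length = m := by rw [h1, length_take]
  have hxj : x ∈ cyl j.β := h1 ▸ mem_cyl_take m x
  refine ⟨j, x, hxj, by omega, hl, ofTriple_eq_iff.mpr ⟨rfl, ?_⟩⟩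
  filter_upwards [(isOpen_cyl _).mem_nhds hxj] with y hy
  exact (h3 y hy).symm

theorem level_subset_kernel (n : ℕ) : (level n).carrier ⊆ kernel.carrier := by
  rintro _ ⟨i, x, hx, hα, hβ, rfl⟩
  show c _ = 0
  rw [c_ofTriple, hα, hβ, sub_self]

/-- `H = ⋃ₙ H_n`. -/
theorem iUnion_level : ⋃ n, (level n).carrier = kernel.carrier := by
  refine Set.Subset.antisymm (Set.iUnion_subset level_subset_kernel) fun γ (hγ : c γ = 0) => ?_
  obtain ⟨i, x, hx, rfl⟩ := GermArr.exists_ofTriple γ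
  rw [c_ofTriple] at hγ
  exact Set.mem_iUnion.mpr ⟨i.β.length, i, x, hx, by omega, rfl, rfl⟩

end SelfSimilarDihedral

/-! The homology of the kernel of the canonical cocycle of the infinite dihedral self-similar
groupoid. -/

/-! ### Push-forwards along injective local homeomorphisms, and pairings with finitely supported
weights. -/

section Pushforward

variable {X Y : Type*} [TopologicalSpace X] [TopologicalSpace Y] [T2Space X] [T2Space Y]

/-! Every chain group is generated by push-forwards along open embeddings of the Cantor space. For
the arrows of `H` these are the sections `z ↦ [α, g, β; βz]` with `|α| = |β|`, and the functions on
the Cantor space are generated by indicators of cylinders. All computations therefore take place on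
the symbols `(α, g, β)`.

Degree zero. The boundary of the bisection `(α, g, β)` is `1_{Z(β)} - 1_{Z(α)}`, so cylinders of
equal length are homologous and the uniform measure kills boundaries (`integral_boundary`). Since
`Z(w) = Z(w0) ⊔ Z(w1)`, every function is homologous to `k · 1_{Z(0^n)}` for all large `n`. Its
integral is `k/2^n`, so an integral equal to zero forces `k = 0`, and every element of `ℤ[1/2]` is
an integral.

Degree one, upper bound. Modulo `im δ₂` the class of `(α, g, β)` is additive under products
(`cls_mul`) and under subdivision of its domain (`cls_split`). Subdividing `a` gives two mutually
inverse matrix units, so `a` contributes zero. Subdividing `b` gives `a` and `b`, so the class of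
`(α, b, α)` is one class `clsB`, independent of `α`, with `2 clsB = 0`. As `a` and `b` generate, any
chain is a multiple of `clsB` plus a combination of matrix units `(α, e, β)` of one length. The
boundary is injective on the span of the classes of the latter (`eq_zero_of_mem_elementary`), so a
cycle is homologous to a multiple of `clsB`.

Degree one, lower bound. The germs at points `w1^∞` are those of `[α, e, β; β1^∞]` and `[α, b, β;
β1^∞]`, and no germ is of both kinds. Marking the second kind by `1` gives a homomorphism `tau : H →
ℤ/2`. It is not continuous, but its support meets each compact set in a finite set, so summing a
chain against it is defined, kills `im δ₂`, and takes the value `1` on `clsB`.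

The inductive limits come from compactness: a chain on `H` is supported in some `H_n`, and the
inclusions are injective on chains. -/

theorem pushforward_congr {π ρ : X → Y} (hπ : IsLocalHomeomorph π) (h : π = ρ) (f : C_c(X, ℤ)) :
    pushforward π hπ f = pushforward ρ (h ▸ hπ) f := by
  subst h
  rfl

theorem pushforward_apply_of_injective {π : X → Y} (hπ : IsLocalHomeomorph π)
    (hi : Function.Injective π) (f : C_c(X, ℤ)) (x : X) : pushforward π hπ f (π x) = f x := by
  rw [pushforward_apply]
  have : {x' | π x' = π x} = {x} := by
    ext x'
    exact hi.eq_iff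
  rw [this, finsum_mem_singleton]

theorem pushforward_apply_of_notMem {π : X → Y} (hπ : IsLocalHomeomorph π) (f : C_c(X, ℤ)) {y : Y}
    (hy : y ∉ Set.range π) : pushforward π hπ f y = 0 := by
  rw [pushforward_apply]
  exact finsum_mem_eq_zero_of_forall_eq_zero fun x hx => absurd ⟨x, hx⟩ hy

theorem pushforward_injective {π : X → Y} (hπ : IsLocalHomeomorph π) (hi : Function.Injective π) :
    Function.Injective (pushforward π hπ) := fun f g h => by
  ext x
  rw [← pushforward_apply_of_injective hπ hi f, h, pushforward_apply_of_injective hπ hi]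

theorem pushforward_id (f : C_c(X, ℤ)) (h : IsLocalHomeomorph (id : X → X)) :
    pushforward id h f = f := by
  ext x
  exact pushforward_apply_of_injective h Function.injective_id f x

/-- A function supported in the range of an open embedding is a push-forward. -/
theorem exists_pushforward_eq {π : X → Y} (hπ : IsLocalHomeomorph π) (hi : Function.Injective π)
    (g : C_c(Y, ℤ)) (hg : tsupport g ⊆ Set.range π) : ∃ f, pushforward π hπ f = g := by
  have hK : IsCompact (tsupport g) := g.hasCompactSupport'
  have he : IsOpenEmbedding π :=
    .of_continuous_injective_isOpenMap hπ.continuous hi hπ.isOpenMap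
  refine ⟨⟨⟨g ∘ π, g.continuous.comp hπ.continuous⟩, ?_⟩, ?_⟩
  · refine HasCompactSupport.intro (he.isInducing.isCompact_preimage' hK hg) fun x hx => ?_
    by_contra hne
    exact hx (subset_tsupport _ hne)
  · ext y
    by_cases hy : y ∈ Set.range π
    · obtain ⟨x, rfl⟩ := hy
      rw [pushforward_apply_of_injective hπ hi]
      rfl
    · rw [pushforward_apply_of_notMem hπ _ hy]
      by_contra hne
      exact hy (hg (subset_tsupport _ (Ne.symm hne)))

/-- The restriction of a compactly supported function to a clopen set, extended by zero. -/
noncomputable def clopenRestrict (f : C_c(X, ℤ)) {U : Set X} (hU : IsClopen U) : C_c(X, ℤ) where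
  toFun := U.indicator f
  continuous_toFun := hU.continuous_indicator f.continuous
  hasCompactSupport' := f.hasCompactSupport'.mono (by
    intro x hx
    rw [Function.mem_support] at hx ⊢
    exact fun h => hx (Set.indicator_apply_eq_zero.mpr fun _ => h))

/-- If `X` is covered by images of open embeddings of a compact space, the push-forwards along
these generate `C_c(X, ℤ)`. -/
theorem mem_of_forall_pushforward_mem {ι : Type*} [CompactSpace X] (σ : ι → X → Y)
    (hσ : ∀ i, IsLocalHomeomorph (σ i)) (hi : ∀ i, Function.Injective (σ i))
    (hs : ∀ y, ∃ i x, σ i x = y) (S : AddSubgroup C_c(Y, ℤ))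
    (hS : ∀ i f, pushforward (σ i) (hσ i) f ∈ S) (f : C_c(Y, ℤ)) : f ∈ S := by
  -- The property is strengthened from `f` to all functions supported in a clopen `U`. In this form
  -- it passes to unions, because a function supported in `U ∪ V` splits along the clopen set `U`.
  have key : ∃ U, IsClopen U ∧ tsupport f ⊆ U ∧
      ∀ g : C_c(Y, ℤ), Function.support g ⊆ U → g ∈ S := by
    refine IsCompact.induction_on (p := fun s => ∃ U, IsClopen U ∧ s ⊆ U ∧
      ∀ g : C_c(Y, ℤ), Function.support g ⊆ U → g ∈ S)
      (f.hasCompactSupport' : IsCompact (tsupport f)) ?_ ?_ ?_ ?_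
    · refine ⟨∅, isClopen_empty, subset_rfl, fun g hg => ?_⟩
      have : g = 0 := by
        ext x
        by_contra h
        exact hg h
      rw [this]
      exact S.zero_mem
    · rintro s t hst ⟨U, hU, htU, H⟩
      exact ⟨U, hU, hst.trans htU, H⟩
    · rintro s t ⟨U, hU, hsU, H⟩ ⟨V, hV, htV, H'⟩
      refine ⟨U ∪ V, hU.union hV, Set.union_subset_union hsU htV, fun g hg => ?_⟩
      have h1 : g = clopenRestrict g hU + clopenRestrict g hU.compl := by
        ext x
        exact (Set.indicator_self_add_compl_apply U g x).symm
      rw [h1]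
      refine S.add_mem (H _ Set.support_indicator_subset) (H' _ fun x hx => ?_)
      have hxU : x ∈ Uᶜ := Set.support_indicator_subset hx
      have hgx : g x ≠ 0 := fun h => hx (Set.indicator_apply_eq_zero.mpr fun _ => h)
      exact (hg hgx).resolve_left hxU
    · intro y _
      obtain ⟨i, x, rfl⟩ := hs y
      -- Closedness uses the compactness of `X`.
      have hcl : IsClopen (Set.range (σ i)) :=
        ⟨(isCompact_range (hσ i).continuous).isClosed, (hσ i).isOpenMap.isOpen_range⟩
      refine ⟨Set.range (σ i), mem_nhdsWithin_of_mem_nhds (hcl.2.mem_nhds ⟨x, rfl⟩),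
        Set.range (σ i), hcl, subset_rfl, fun g hg => ?_⟩
      obtain ⟨g', rfl⟩ := exists_pushforward_eq (hσ i) (hi i) g (closure_minimal hg hcl.1)
      exact hS i g'
  obtain ⟨U, -, hU, H⟩ := key
  exact H f ((subset_tsupport _).trans hU)

variable {R : Type*} [CommRing R]

/-- The pairing `f ↦ ∑ t(x) f(x)` with a function `t` whose support meets every compact set in a
finite set. -/
noncomputable def pairing (t : X → R) (ht : ∀ K, IsCompact K → (K ∩ Function.support t).Finite) :
    C_c(X, ℤ) →+ R where
  toFun f := ∑ᶠ x, t x * f x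
  map_zero' := by simp
  map_add' f g := by
    have h : ∀ f : C_c(X, ℤ), (Function.support fun x => t x * f x).Finite := fun f =>
      (ht _ f.hasCompactSupport').subset fun x hx => by
        rw [Function.mem_support] at hx
        refine ⟨subset_tsupport _ fun (h : f x = 0) => hx ?_, left_ne_zero_of_mul hx⟩
        rw [h, Int.cast_zero, mul_zero]
    rw [← finsum_add_distrib (h f) (h g)]
    refine finsum_congr fun x => ?_
    push_cast [CompactlySupportedContinuousMap.add_apply]
    ring

-- The image of the support of `f` is compact, so it contains only finitely many points where `t` is
-- nonzero, and each fibre over such a point meets the support of `f` in a finite set. No continuity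
-- of `t` is needed.
set_option linter.unusedSectionVars false in
theorem finite_support_comp_mul {π : X → Y} (hπ : IsLocalHomeomorph π) {t : Y → R}
    (ht : ∀ K, IsCompact K → (K ∩ Function.support t).Finite) (f : C_c(X, ℤ)) :
    (Function.support fun x => t (π x) * f x).Finite := by
  refine ((ht _ ((f.hasCompactSupport' : IsCompact (tsupport f)).image hπ.continuous)).biUnion
    fun y _ => finite_fiber_inter_support hπ f y).subset fun x hx => ?_
  rw [Function.mem_support] at hx
  have hf : f x ≠ 0 := fun h => hx (by rw [h, Int.cast_zero, mul_zero])
  simp only [Set.mem_iUnion]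
  exact ⟨π x, ⟨⟨x, subset_tsupport _ hf, rfl⟩, left_ne_zero_of_mul hx⟩, rfl, hf⟩

/-- This is summation over fibres. It turns identities between weights composed with face maps into
identities between pairings of chains. -/
theorem pairing_pushforward {π : X → Y} (hπ : IsLocalHomeomorph π) (t : Y → R)
    (ht : ∀ K, IsCompact K → (K ∩ Function.support t).Finite) (f : C_c(X, ℤ)) :
    pairing t ht (pushforward π hπ f) = ∑ᶠ x, t (π x) * f x := by
  classical
  have hfin := finite_support_comp_mul hπ ht f
  have h1 : ∀ y, t y * (pushforward π hπ f y : ℤ) =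
      ∑ x ∈ hfin.toFinset with π x = y, t (π x) * f x := by
    intro y
    -- The index set `hfin` omits the whole fibre when `t y = 0`; that case is trivial and is
    -- treated apart.
    by_cases hy : t y = 0
    · rw [hy, zero_mul]
      refine (Finset.sum_eq_zero fun x hx => ?_).symm
      rw [(Finset.mem_filter.mp hx).2, hy, zero_mul]
    · rw [pushforward_apply, finsum_mem_eq_sum f (finite_fiber_inter_support hπ f y),
        Int.cast_sum, Finset.mul_sum]
      symm
      -- The fibre may contain points with `f x ≠ 0` whose term vanishes in `R`, for instance when
      -- `f x` is even and `R = ZMod 2`; these are the points of the difference.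
      refine Finset.sum_subset_zero_on_sdiff ?_ ?_ ?_
      · intro x hx
        simp only [Finset.mem_filter, Set.Finite.mem_toFinset, Function.mem_support] at hx
        simp only [Set.Finite.mem_toFinset]
        exact ⟨hx.2, fun h => hx.1 (by rw [h, Int.cast_zero, mul_zero])⟩
      · intro x hx
        simp only [Finset.mem_sdiff, Finset.mem_filter, Set.Finite.mem_toFinset, Set.mem_inter_iff,
          Function.mem_support, Set.mem_ofPred_eq, not_and] at hx
        obtain ⟨⟨rfl, hx1⟩, hx2⟩ := hx
        by_contra hne
        exact hx2 hne rfl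
      · intro x hx
        rw [(Finset.mem_filter.mp hx).2]
  change ∑ᶠ y, t y * (pushforward π hπ f y : ℤ) = _
  rw [finsum_eq_sum_of_support_toFinset_subset _ hfin subset_rfl, finsum_congr h1,
    finsum_eq_sum_of_support_subset (s := hfin.toFinset.image π)]
  · rw [Finset.sum_fiberwise_of_maps_to fun x hx => Finset.mem_image_of_mem π hx]
  · intro y hy
    obtain ⟨x, hx, -⟩ := Finset.exists_ne_zero_of_sum_ne_zero hy
    rw [Finset.mem_filter] at hx
    exact Finset.mem_coe.mpr (Finset.mem_image.mpr ⟨x, hx.1, hx.2⟩)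

end Pushforward

theorem nonempty_quotient_addEquiv {A B : Type*} [AddCommGroup A] [AddCommGroup B]
    (S : AddSubgroup A) (φ : A →+ B) (hφ : Function.Surjective φ) (h : ∀ x, x ∈ S ↔ φ x = 0) :
    Nonempty (A ⧸ S ≃+ B) := by
  have hS : S = φ.ker := AddSubgroup.ext h
  exact ⟨(QuotientAddGroup.quotientAddEquivOfEq hS).trans
    (QuotientAddGroup.quotientKerEquivOfSurjective φ hφ)⟩

namespace SelfSimilarDihedral

/-! ### Integer-valued functions on the Cantor space -/

/-- The constant function `1` on the Cantor space. -/
noncomputable def oneC : C_c(Cantor, ℤ) where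
  toFun _ := 1
  continuous_toFun := continuous_const
  hasCompactSupport' := HasCompactSupport.of_compactSpace _

theorem isLocalHomeomorph_app (w : List Bool) : IsLocalHomeomorph (app w) :=
  (IsOpenEmbedding.of_continuous_injective_isOpenMap (continuous_app w) (app_injective w)
    (isOpenMap_app w)).isLocalHomeomorph

/-- The homeomorphism of the Cantor space given by `g`. -/
def actHomeo (g : Γ) : Cantor ≃ₜ Cantor where
  toFun := act g
  invFun := act g⁻¹
  left_inv := act_inv_act g
  right_inv := act_act_inv g
  continuous_toFun := continuous_act g
  continuous_invFun := continuous_act g⁻¹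

theorem isLocalHomeomorph_act (g : Γ) : IsLocalHomeomorph (act g) :=
  (actHomeo g).isLocalHomeomorph

/-- The push-forward along `z ↦ w z`; it maps `1` to the indicator function of `Z(w)`. -/
noncomputable def pushApp (w : List Bool) : C_c(Cantor, ℤ) →+ C_c(Cantor, ℤ) :=
  pushforward (app w) (isLocalHomeomorph_app w)

/-- The push-forward along `z ↦ g · z`. -/
noncomputable def pushAct (g : Γ) : C_c(Cantor, ℤ) →+ C_c(Cantor, ℤ) :=
  pushforward (act g) (isLocalHomeomorph_act g)

theorem pushApp_nil (f : C_c(Cantor, ℤ)) : pushApp [] f = f := pushforward_id f _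

theorem pushApp_append (u v : List Bool) (f : C_c(Cantor, ℤ)) :
    pushApp (u ++ v) f = pushApp u (pushApp v f) := by
  rw [pushApp, pushApp, pushApp, pushforward_comp]
  exact pushforward_congr _ (funext fun z => app_append u v z) f

theorem pushAct_pushApp (g : Γ) (w : List Bool) (f : C_c(Cantor, ℤ)) :
    pushAct g (pushApp w f) = pushApp (actW g w) (pushAct (secW g w) f) := by
  rw [pushApp, pushApp, pushAct, pushAct, pushforward_comp, pushforward_comp]
  exact pushforward_congr _ (funext fun z => act_app g w z) f

theorem pushAct_oneC (g : Γ) : pushAct g oneC = oneC := by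
  ext z
  rw [← act_act_inv g z]
  exact pushforward_apply_of_injective _ (actHomeo g).injective oneC _

theorem pushApp_apply_app (w : List Bool) (f : C_c(Cantor, ℤ)) (z : Cantor) :
    pushApp w f (app w z) = f z :=
  pushforward_apply_of_injective _ (app_injective w) f z

/-- The function `z ↦ f(w z)`. -/
noncomputable def pullApp (w : List Bool) (f : C_c(Cantor, ℤ)) : C_c(Cantor, ℤ) where
  toFun z := f (app w z)
  continuous_toFun := f.continuous.comp (continuous_app w)
  hasCompactSupport' := HasCompactSupport.of_compactSpace _

theorem pushApp_apply_of_ne {v w : List Bool} (hl : v.length = w.length) (hne : v ≠ w)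
    (f : C_c(Cantor, ℤ)) (z : Cantor) : pushApp w f (app v z) = 0 := by
  refine pushforward_apply_of_notMem _ f ?_
  rintro ⟨z', h⟩
  exact hne (app_eq_app hl.symm h).1.symm

theorem pushApp_pullApp_add (f : C_c(Cantor, ℤ)) :
    pushApp [false] (pullApp [false] f) + pushApp [true] (pullApp [true] f) = f := by
  ext z
  rw [CompactlySupportedContinuousMap.add_apply]
  have hz : z = app [z 0] (tail z) := (cons_tail z).symm
  rw [hz]
  cases z 0
  · rw [pushApp_apply_app, pushApp_apply_of_ne (v := [false]) (w := [true]) rfl (by decide), add_zero]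
    rfl
  · rw [pushApp_apply_app, pushApp_apply_of_ne (v := [true]) (w := [false]) rfl (by decide), zero_add]
    rfl

/-- Both pull-backs of the constant `1` are again the constant `1`. -/
theorem oneC_eq : pushApp [false] oneC + pushApp [true] oneC = oneC :=
  pushApp_pullApp_add oneC

/-- A continuous integer-valued function is locally constant, and compactness makes the length of
the prefix uniform. -/
theorem exists_take_eq (f : C_c(Cantor, ℤ)) :
    ∃ n, ∀ w : List Bool, n ≤ w.length → ∀ y z, f (app w y) = f (app w z) := by
  have h : ∃ n, ∀ x : Cantor, ∀ z z', f (app (take n x) z) = f (app (take n x) z') := by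
    -- The condition is imposed for all `m ≥ n`, so that two pieces with different bounds can be
    -- joined at the larger one.
    have := IsCompact.induction_on (p := fun s => ∃ n, ∀ x ∈ s, ∀ m ≥ n, ∀ z z',
      f (app (take m x) z) = f (app (take m x) z')) (isCompact_univ (X := Cantor)) ?_ ?_ ?_ ?_
    · obtain ⟨n, hn⟩ := this
      exact ⟨n, fun x => hn x trivial n le_rfl⟩
    · exact ⟨0, by simp⟩
    · rintro s t hst ⟨n, hn⟩
      exact ⟨n, fun x hx => hn x (hst hx)⟩
    · rintro s t ⟨n, hn⟩ ⟨m, hm⟩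
      refine ⟨max n m, ?_⟩
      rintro x (hx | hx) k hk
      · exact hn x hx k (le_of_max_le_left hk)
      · exact hm x hx k (le_of_max_le_right hk)
    · intro x _
      have hU : f ⁻¹' {f x} ∈ 𝓝 x :=
        ((isOpen_discrete _).preimage f.continuous).mem_nhds rfl
      obtain ⟨n, -, hn⟩ := exists_cyl_subset hU 0
      refine ⟨cyl (take n x), mem_nhdsWithin_of_mem_nhds
        ((isOpen_cyl _).mem_nhds (mem_cyl_take n x)), n, fun y hy m hm z z' => ?_⟩
      have h2 : ∀ z, f (app (take m y) z) = f x := by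
        intro z
        obtain ⟨v, hv⟩ := exists_append (by simpa [length_take] using hm) hy (mem_cyl_take m y)
        rw [hv, app_append]
        exact hn ⟨_, rfl⟩
      rw [h2, h2]
  obtain ⟨n, hn⟩ := h
  refine ⟨n, fun w hw y z => ?_⟩
  obtain ⟨v, hv⟩ := exists_append (by simpa [length_take] using hw)
    (mem_cyl_take n (app w y)) ⟨y, rfl⟩
  rw [hv, app_append, app_append]
  have := hn (app w y) (app v y) (app v z)
  exact this

/-- `f` depends only on the first `n` letters. -/
def Level (n : ℕ) (f : C_c(Cantor, ℤ)) : Prop :=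
  ∀ w : List Bool, w.length = n → ∀ y z, f (app w y) = f (app w z)

theorem Level.pull {n : ℕ} {f : C_c(Cantor, ℤ)} (h : Level (n + 1) f) (x : Bool) :
    Level n (pullApp [x] f) := fun w hw y z => h (x :: w) (by simpa using hw) y z

theorem exists_level (f : C_c(Cantor, ℤ)) : ∃ n, ∀ m ≥ n, Level m f := by
  obtain ⟨n, hn⟩ := exists_take_eq f
  exact ⟨n, fun m hm w hw => hn w (by omega)⟩

theorem level_zero_iff {f : C_c(Cantor, ℤ)} (h : Level 0 f) (z : Cantor) : f = f z • oneC := by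
  ext y
  have := h [] rfl y z
  simp only [app] at this
  rw [this]
  simp [oneC]

/-- The indicator functions of the cylinder sets generate `C(X^∞, ℤ)`. -/
theorem mem_of_forall_pushApp_mem (S : AddSubgroup C_c(Cantor, ℤ))
    (hS : ∀ w, pushApp w oneC ∈ S) (f : C_c(Cantor, ℤ)) : f ∈ S := by
  obtain ⟨n, hn⟩ := exists_level f
  have hf := hn n le_rfl
  clear hn
  induction n generalizing f S with
  | zero =>
    rw [level_zero_iff hf fun _ => false]
    exact S.zsmul_mem (by simpa [pushApp_nil] using hS []) _
  | succ n ih =>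
    rw [← pushApp_pullApp_add f]
    -- The induction hypothesis is applied to the preimage of `S` under prefixing by `x`, which is
    -- why `S` varies in the induction.
    have : ∀ x, pushApp [x] (pullApp [x] f) ∈ S := fun x =>
      ih (S.comap (pushApp [x])) (fun w => by
        rw [AddSubgroup.mem_comap, ← pushApp_append]
        exact hS _) _ (hf.pull x)
    exact S.add_mem (this false) (this true)

theorem hom_ext_pushApp {A : Type*} [AddCommGroup A] {φ ψ : C_c(Cantor, ℤ) →+ A}
    (h : ∀ w, φ (pushApp w oneC) = ψ (pushApp w oneC)) : φ = ψ :=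
  AddMonoidHom.ext fun f => mem_of_forall_pushApp_mem (AddMonoidHom.eqLocus φ ψ) h f

/-! ### Weighted sums over the words of a given length. -/

section WordSum

variable {A : Type*} [AddCommGroup A]

/-- `∑_{|w| = n} f(w 0^∞) F(w)`. -/
noncomputable def wordSum : ℕ → (List Bool → A) → C_c(Cantor, ℤ) →+ A
  | 0, F =>
    { toFun := fun f => f (fun _ => false) • F []
      map_zero' := zero_smul _ _
      map_add' := fun _ _ => add_smul _ _ _ }
  | n + 1, F =>
    { toFun := fun f => wordSum n (fun w => F (false :: w)) (pullApp [false] f) +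
        wordSum n (fun w => F (true :: w)) (pullApp [true] f)
      map_zero' := by
        have : ∀ x, pullApp [x] (0 : C_c(Cantor, ℤ)) = 0 := fun _ => rfl
        simp [this]
      map_add' := fun f g => by
        have : ∀ x, pullApp [x] (f + g) = pullApp [x] f + pullApp [x] g := fun _ => rfl
        simp only [this, map_add]
        abel }

theorem wordSum_zero (F : List Bool → A) (f : C_c(Cantor, ℤ)) :
    wordSum 0 F f = f (fun _ => false) • F [] := rfl

theorem wordSum_succ (n : ℕ) (F : List Bool → A) (f : C_c(Cantor, ℤ)) :
    wordSum (n + 1) F f = wordSum n (fun w => F (false :: w)) (pullApp [false] f) +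
      wordSum n (fun w => F (true :: w)) (pullApp [true] f) := rfl

theorem pullApp_pushApp_self (x : Bool) (w : List Bool) (f : C_c(Cantor, ℤ)) :
    pullApp [x] (pushApp (x :: w) f) = pushApp w f := by
  ext z
  rw [show (x :: w) = [x] ++ w from rfl, pushApp_append]
  exact pushApp_apply_app [x] _ z

theorem pullApp_pushApp_ne {x y : Bool} (h : x ≠ y) (w : List Bool) (f : C_c(Cantor, ℤ)) :
    pullApp [x] (pushApp (y :: w) f) = 0 := by
  ext z
  rw [show (y :: w) = [y] ++ w from rfl, pushApp_append]
  exact pushApp_apply_of_ne (v := [x]) (w := [y]) rfl (by simpa using h) _ z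

/-- Among the words of length `|w|`, only `w` itself has its sample point in `Z(w)`. -/
theorem wordSum_pushApp (w : List Bool) (F : List Bool → A) :
    wordSum w.length F (pushApp w oneC) = F w := by
  induction w generalizing F with
  | nil =>
    rw [pushApp_nil, List.length_nil, wordSum_zero]
    exact one_smul _ _
  | cons x w ih =>
    rw [List.length_cons, wordSum_succ]
    cases x
    · rw [pullApp_pushApp_self, pullApp_pushApp_ne (by decide), ih, map_zero, add_zero]
    · rw [pullApp_pushApp_self, pullApp_pushApp_ne (by decide), ih, map_zero, zero_add]

/-- The function `f` takes one value on each cylinder of length `n`, so the terms at `w0` and `w1`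
have the same coefficient and can be merged. Additive weights thus give sums that stabilise in `n`.
-/
theorem wordSum_succ_of_level {n : ℕ} {F F' : List Bool → A} {f : C_c(Cantor, ℤ)} (hf : Level n f)
    (hF : ∀ w, w.length = n → F w = F' (w ++ [false]) + F' (w ++ [true])) :
    wordSum (n + 1) F' f = wordSum n F f := by
  induction n generalizing f F F' with
  | zero =>
    have h : ∀ x, pullApp [x] f (fun _ => false) = f (fun _ => false) := fun x => hf [] rfl _ _
    rw [wordSum_succ, wordSum_zero, wordSum_zero, wordSum_zero, hF [] rfl, smul_add, h, h]
    rfl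
  | succ n ih =>
    rw [wordSum_succ, wordSum_succ]
    congr 1
    · exact ih (F := fun w => F (false :: w)) (F' := fun w => F' (false :: w)) (hf.pull _)
        fun w hw => hF (false :: w) (by simpa using hw)
    · exact ih (F := fun w => F (true :: w)) (F' := fun w => F' (true :: w)) (hf.pull _)
        fun w hw => hF (true :: w) (by simpa using hw)

end WordSum

end SelfSimilarDihedral

/-! ### One-chains of `H` carried by bisections. -/

namespace SelfSimilarDihedral

open GermArr

/-- The groupoid `H = c⁻¹(0)`. -/
noncomputable abbrev K : EtaleGroupoid := kernel.toEtale

theorem app_mem_cyl (w : List Bool) (z : Cantor) : app w z ∈ cyl w := ⟨z, rfl⟩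

/-- The section `z ↦ [α, g, β; β z]` of `H`. -/
def germSec (i : Triple) (h : i.α.length = i.β.length) (z : Cantor) : K.Arr :=
  ⟨ofTriple i (app i.β z) (app_mem_cyl _ z),
    (c_ofTriple _ _ _).trans (sub_eq_zero.mpr (congrArg _ h))⟩

theorem rng_germSec (i : Triple) (h : i.α.length = i.β.length) :
    (fun z => K.rng (germSec i h z)) = app i.α ∘ act i.g := funext fun z => i.S_app z

theorem germSec_injective (i : Triple) (h : i.α.length = i.β.length) :
    Function.Injective (germSec i h) := fun _ _ e =>
  app_injective i.β (congrArg K.src e)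

/-- The source of the section at `z` is `βz`, and both `K.src` and `z ↦ βz` are local
homeomorphisms; only continuity remains, and it holds because equality of germs at a point spreads
to a neighbourhood. -/
theorem isLocalHomeomorph_germSec (i : Triple) (h : i.α.length = i.β.length) :
    IsLocalHomeomorph (germSec i h) := by
  refine IsLocalHomeomorph.of_comp (g := K.src) ?_ K.isLocalHomeomorph_src ?_
  · exact isLocalHomeomorph_app i.β
  · refine Continuous.subtype_mk ?_ _
    refine continuous_generateFrom_iff.mpr ?_
    rintro _ ⟨j, U, hU, rfl⟩
    refine isOpen_iff_mem_nhds.mpr ?_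
    rintro z ⟨y, hy, hyU, e⟩
    obtain ⟨rfl, hS⟩ := ofTriple_eq_iff.mp e
    refine (continuous_app i.β).continuousAt.preimage_mem_nhds (t :=
      {y | ∃ hy : y ∈ cyl j.β, y ∈ U ∧ i.S =ᶠ[𝓝 y] j.S}) ?_ |> Filter.mem_of_superset <| ?_
    · filter_upwards [hS.eventuallyEq_nhds, hU.mem_nhds hyU, (isOpen_cyl j.β).mem_nhds hy]
        with y h1 h2 h3
      exact ⟨h3, h2, h1⟩
    · rintro z ⟨h1, h2, h3⟩
      exact ⟨_, h1, h2, ofTriple_eq_iff.mpr ⟨rfl, h3⟩⟩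

theorem exists_germSec (γ : K.Arr) : ∃ i h z, germSec i h z = γ := by
  obtain ⟨γ, hγ⟩ := γ
  obtain ⟨i, x, ⟨z, rfl⟩, rfl⟩ := GermArr.exists_ofTriple γ
  have h := (c_ofTriple i _ (app_mem_cyl _ z)).symm.trans hγ
  exact ⟨i, by omega, z, rfl⟩

/-- The chain `f` on the bisection `{[α, g, β; β z]}`. -/
noncomputable def chainSec (i : Triple) (h : i.α.length = i.β.length) :
    C_c(Cantor, ℤ) →+ C_c(K.Arr, ℤ) :=
  pushforward (germSec i h) (isLocalHomeomorph_germSec i h)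

/-- The boundary `δ₁` of `H`. -/
noncomputable def boundary : C_c(K.Arr, ℤ) →+ C_c(Cantor, ℤ) := K.δ₁

/-- Along the section the source is `βz` and the range is `α(g · z)`, so `s_* - r_*` becomes a
difference of two push-forwards from the Cantor space. -/
theorem boundary_chainSec (i : Triple) (h : i.α.length = i.β.length) (f : C_c(Cantor, ℤ)) :
    boundary (chainSec i h f) = pushApp i.β f - pushApp i.α (pushAct i.g f) := by
  have hs : IsLocalHomeomorph (K.src : K.Arr → Cantor) := K.isLocalHomeomorph_src
  have hr : IsLocalHomeomorph (K.rng : K.Arr → Cantor) := K.isLocalHomeomorph_rng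
  have h1 : boundary (chainSec i h f) =
      pushforward _ hs (chainSec i h f) - pushforward _ hr (chainSec i h f) := rfl
  rw [h1, chainSec, pushforward_comp, pushforward_comp, pushApp, pushAct, pushApp, pushforward_comp]
  congr 1
  exact pushforward_congr _ (rng_germSec i h) f

/-- `C_c(H, ℤ)` is generated by the chains supported on the bisections `{[α, g, β; β z]}`. -/
theorem mem_of_forall_chainSec_mem (S : AddSubgroup C_c(K.Arr, ℤ))
    (hS : ∀ i h f, chainSec i h f ∈ S) (f : C_c(K.Arr, ℤ)) : f ∈ S := by
  refine mem_of_forall_pushforward_mem (X := Cantor)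
    (fun i : {i : Triple // i.α.length = i.β.length} => germSec i.1 i.2)
    (fun i => isLocalHomeomorph_germSec _ _) (fun i => germSec_injective _ _) ?_ S
    (fun i f => hS _ _ f) f
  intro γ
  obtain ⟨i, h, z, rfl⟩ := exists_germSec γ
  exact ⟨⟨i, h⟩, z, rfl⟩

/-! ### The zeroth homology, by integration against the uniform measure. -/

section ZerothHomology

/-- The ring `ℤ[1/2]`. -/
abbrev ZHalf : Type := Localization.Away (2 : ℤ)

/-- The element `1/2`. -/
noncomputable def half : ZHalf := IsLocalization.Away.invSelf (2 : ℤ)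

theorem two_mul_half : 2 * half = 1 := by
  have := IsLocalization.Away.mul_invSelf (S := ZHalf) (2 : ℤ)
  simpa [half] using this

theorem half_pow_eq (n : ℕ) : half ^ n = half ^ (n + 1) + half ^ (n + 1) := by
  rw [← two_mul, pow_succ', ← _root_.mul_assoc, two_mul_half, _root_.one_mul]

/-- The weights `2^{-m}` satisfy `2^{-m} = 2^{-(m+1)} + 2^{-(m+1)}`, so the sums are constant from
the level of `f` on. The eventual value is the integral. -/
theorem exists_integral_eq (f : C_c(Cantor, ℤ)) :
    ∃ v : ZHalf, ∃ n, ∀ m ≥ n, wordSum m (fun _ => half ^ m) f = v := by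
  obtain ⟨n, hn⟩ := exists_level f
  refine ⟨wordSum n (fun _ => half ^ n) f, n, fun m hm => ?_⟩
  induction m, hm using Nat.le_induction with
  | base => rfl
  | succ m hm ih =>
    rw [← ih]
    exact wordSum_succ_of_level (hn m hm) fun _ _ => half_pow_eq m

/-- The integral `C(X^∞, ℤ) → ℤ[1/2]` for the uniform measure, `1_{Z(w)} ↦ 2^{-|w|}`. -/
noncomputable def integral : C_c(Cantor, ℤ) →+ ZHalf where
  toFun f := (exists_integral_eq f).choose
  map_zero' := by
    obtain ⟨n, hn⟩ := (exists_integral_eq 0).choose_spec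
    rw [← hn n le_rfl, map_zero]
  map_add' f g := by
    obtain ⟨n, hn⟩ := (exists_integral_eq (f + g)).choose_spec
    obtain ⟨m, hm⟩ := (exists_integral_eq f).choose_spec
    obtain ⟨k, hk⟩ := (exists_integral_eq g).choose_spec
    -- The three integrals are read off at one common length, beyond all three thresholds.
    rw [← hn (n + m + k) (by omega), ← hm (n + m + k) (by omega), ← hk (n + m + k) (by omega),
      map_add]

theorem integral_pushApp (w : List Bool) : integral (pushApp w oneC) = half ^ w.length := by
  obtain ⟨n, hn⟩ := (exists_integral_eq (pushApp w oneC)).choose_spec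
  change (exists_integral_eq (pushApp w oneC)).choose = _
  -- The threshold `n` is unknown, so the sum is taken at length `n + |w|` and brought down to
  -- length `|w|`, where it is a single term.
  rw [← hn (n + w.length) (by omega)]
  clear hn
  induction n with
  | zero => rw [Nat.zero_add, wordSum_pushApp]
  | succ n ih =>
    rw [← ih, show n + 1 + w.length = n + w.length + 1 by omega]
    refine wordSum_succ_of_level ?_ fun _ _ => half_pow_eq _
    intro v hv y z
    -- The indicator of `Z(w)` is constant on `Z(v)` for `|v| ≥ |w|`: what matters is whether the
    -- first `|w|` letters of `v` form `w`.
    rw [← List.take_append_drop w.length v, app_append, app_append]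
    have hl : (v.take w.length).length = w.length := by
      rw [List.length_take]; omega
    by_cases h : v.take w.length = w
    · rw [h, pushApp_apply_app, pushApp_apply_app]
      rfl
    · rw [pushApp_apply_of_ne hl h, pushApp_apply_of_ne hl h]

/-- An element `g` carries `Z(w)` onto `Z(g · w)`, a cylinder of the same length, so the uniform
measure is invariant. -/
theorem integral_pushAct (g : Γ) (f : C_c(Cantor, ℤ)) : integral (pushAct g f) = integral f := by
  have : integral.comp (pushAct g) = integral := hom_ext_pushApp fun w => by
    rw [AddMonoidHom.comp_apply, pushAct_pushApp, pushAct_oneC, integral_pushApp,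
      integral_pushApp, length_actW]
  exact DFunLike.congr_fun this f

theorem integral_pushApp_apply (w : List Bool) (f : C_c(Cantor, ℤ)) :
    integral (pushApp w f) = half ^ w.length * integral f := by
  have : integral.comp (pushApp w) = (AddMonoidHom.mulLeft (half ^ w.length)).comp integral :=
    hom_ext_pushApp fun v => by
      rw [AddMonoidHom.comp_apply, AddMonoidHom.comp_apply, ← pushApp_append, integral_pushApp,
        integral_pushApp, List.length_append, pow_add]
      rfl
  exact DFunLike.congr_fun this f

/-- On a bisection `(α, g, β)` the two terms of the boundary have integrals `2^{-|β|} ∫ f` and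
`2^{-|α|} ∫ f`, and in `H` the lengths agree. -/
theorem integral_boundary (f : C_c(K.Arr, ℤ)) : integral (boundary f) = 0 := by
  refine mem_of_forall_chainSec_mem (AddMonoidHom.ker (integral.comp boundary)) (fun i h f => ?_) f
  rw [AddMonoidHom.mem_ker, AddMonoidHom.comp_apply, boundary_chainSec]
  rw [map_sub, integral_pushApp_apply, integral_pushApp_apply, integral_pushAct, h, sub_self]

/-- The bisection `(α, e, β)` joins the two cylinders. -/
theorem pushApp_sub_mem (α β : List Bool) (h : α.length = β.length) :
    pushApp β oneC - pushApp α oneC ∈ boundary.range := by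
  refine ⟨chainSec ⟨α, 1, β⟩ h oneC, ?_⟩
  rw [boundary_chainSec, pushAct_oneC]

/-- Each cylinder is the disjoint union of its two halves, which are homologous to each other; every
added letter therefore contributes a factor `2`. -/
theorem pushApp_replicate_mem (n m : ℕ) : pushApp (List.replicate n false) oneC -
    (2 : ℤ) ^ m • pushApp (List.replicate (n + m) false) oneC ∈ boundary.range := by
  induction m with
  | zero => simp
  | succ m ih =>
    set w := List.replicate (n + m) false
    have h1 : List.replicate (n + (m + 1)) false = w ++ [false] := List.replicate_succ'
    have h2 : pushApp w oneC = pushApp (w ++ [false]) oneC + pushApp (w ++ [true]) oneC := by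
      rw [pushApp_append, pushApp_append, ← map_add, oneC_eq]
    have h3 := pushApp_sub_mem (w ++ [false]) (w ++ [true]) (by simp)
    have h4 := add_mem ih (zsmul_mem h3 ((2 : ℤ) ^ m))
    rw [h1]
    convert h4 using 1
    rw [h2, pow_succ]
    module

/-- All cylinders of one length are homologous, so any function reduces to a multiple of one of
them. The reduction is stated for all large `n`, so that two functions can be compared on the same
`Z(0^n)`. -/
theorem exists_zsmul (f : C_c(Cantor, ℤ)) : ∃ N, ∀ n ≥ N, ∃ k : ℤ,
    f - k • pushApp (List.replicate n false) oneC ∈ boundary.range := by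
  let S : AddSubgroup C_c(Cantor, ℤ) :=
    { carrier := {f | ∃ N, ∀ n ≥ N, ∃ k : ℤ,
        f - k • pushApp (List.replicate n false) oneC ∈ boundary.range}
      zero_mem' := ⟨0, fun n _ => ⟨0, by simp⟩⟩
      add_mem' := by
        rintro f g ⟨N, hN⟩ ⟨M, hM⟩
        refine ⟨max N M, fun n hn => ?_⟩
        obtain ⟨k, hk⟩ := hN n (le_of_max_le_left hn)
        obtain ⟨l, hl⟩ := hM n (le_of_max_le_right hn)
        refine ⟨k + l, ?_⟩
        convert add_mem hk hl using 1
        module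
      neg_mem' := by
        rintro f ⟨N, hN⟩
        refine ⟨N, fun n hn => ?_⟩
        obtain ⟨k, hk⟩ := hN n hn
        refine ⟨-k, ?_⟩
        convert neg_mem hk using 1
        module }
  refine mem_of_forall_pushApp_mem S (fun w => ⟨w.length, fun n hn => ?_⟩) f
  obtain ⟨m, rfl⟩ := Nat.exists_eq_add_of_le hn
  refine ⟨2 ^ m, ?_⟩
  have h1 := pushApp_sub_mem (List.replicate w.length false) w (by simp)
  convert add_mem h1 (pushApp_replicate_mem w.length m) using 1
  module

theorem half_pow_mul (n : ℕ) : 2 ^ n * half ^ n = 1 := by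
  rw [← mul_pow, two_mul_half, one_pow]

/-- The reduced form `k · 1_{Z(0^n)}` has integral `k · 2^{-n}`. If this is zero then `k = 0`, since
`2` is invertible and `ℤ` embeds in `ℤ[1/2]`. -/
theorem mem_range_boundary_of_integral_eq_zero {f : C_c(Cantor, ℤ)} (hf : integral f = 0) :
    f ∈ boundary.range := by
  obtain ⟨n, hn⟩ := exists_zsmul f
  obtain ⟨k, hk⟩ := hn n le_rfl
  have hk0 : k = 0 := by
    obtain ⟨g, hg⟩ := hk
    have h1 := integral_boundary g
    rw [hg, map_sub, hf, map_zsmul, integral_pushApp, List.length_replicate, zero_sub,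
      neg_eq_zero, zsmul_eq_mul] at h1
    have h2 : (k : ZHalf) = 0 := by
      calc (k : ZHalf) = k * half ^ n * 2 ^ n := by
            rw [_root_.mul_assoc, mul_comm (half ^ n), half_pow_mul, _root_.mul_one]
        _ = 0 := by rw [h1, zero_mul]
    have h3 : Function.Injective (algebraMap ℤ ZHalf) :=
      IsLocalization.injective (M := Submonoid.powers (2 : ℤ)) _ (Submonoid.powers_le.mpr (by simp))
    exact h3 (by simpa using h2)
  rw [hk0, zero_smul, sub_zero] at hk
  exact hk

theorem integral_surjective : Function.Surjective integral := by
  intro x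
  obtain ⟨⟨k, _, n, rfl⟩, hx⟩ := IsLocalization.surj (Submonoid.powers (2 : ℤ)) x
  refine ⟨k • pushApp (List.replicate n false) oneC, ?_⟩
  rw [map_zsmul, integral_pushApp, List.length_replicate, zsmul_eq_mul]
  simp only [map_pow, eq_intCast, Int.cast_ofNat] at hx
  rw [← hx, _root_.mul_assoc, half_pow_mul, _root_.mul_one]

/-- `H₀(H) ≅ ℤ[1/2]`. -/
theorem nonempty_H₀_equiv : Nonempty (K.H₀ ≃+ ZHalf) := by
  exact nonempty_quotient_addEquiv (A := C_c(K.Ob, ℤ)) K.δ₁.range integral integral_surjective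
    fun f => ⟨by rintro ⟨g, rfl⟩; exact integral_boundary g,
      fun hf => mem_range_boundary_of_integral_eq_zero hf⟩

end ZerothHomology

end SelfSimilarDihedral

/-! ### Homology of increasing unions of open subgroupoids. -/

/-- Every element of the limit comes from one stage, so injectivity of the induced map can be tested
there: an element that dies in `P` must already die at a later stage. -/
theorem exists_directLimit_addEquiv {H : ℕ → Type*} [∀ n, AddCommGroup (H n)]
    (f : ∀ n m, n ≤ m → H n →+ H m) {P : Type*} [AddCommGroup P] (g : ∀ n, H n →+ P)
    (hg : ∀ n m h x, g m (f n m h x) = g n x) (hs : ∀ y, ∃ n x, g n x = y)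
    (hi : ∀ n x, g n x = 0 → ∃ m h, f n m h x = 0) :
    ∃ e : AddCommGroup.DirectLimit H f ≃+ P,
      ∀ n x, e (AddCommGroup.DirectLimit.of H f n x) = g n x := by
  let φ := AddCommGroup.DirectLimit.lift H f P g hg
  have hφ : Function.Bijective φ := by
    constructor
    · rw [injective_iff_map_eq_zero]
      intro z hz
      induction z using AddCommGroup.DirectLimit.induction_on with
      | ih n x =>
        rw [AddCommGroup.DirectLimit.lift_of] at hz
        obtain ⟨m, h, hx⟩ := hi n x hz
        rw [← AddCommGroup.DirectLimit.of_f h, hx, map_zero]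
    · intro y
      obtain ⟨n, x, rfl⟩ := hs y
      exact ⟨_, AddCommGroup.DirectLimit.lift_of P g hg n x⟩
  exact ⟨AddEquiv.ofBijective φ hφ, AddCommGroup.DirectLimit.lift_of P g hg⟩

/-- A compactly supported function on an increasing union of open subspaces lives on one of
them. -/
theorem exists_pushforward_eq_of_monotone {X : ℕ → Type*} {Y : Type*}
    [∀ n, TopologicalSpace (X n)] [TopologicalSpace Y] [∀ n, T2Space (X n)] [T2Space Y]
    (π : ∀ n, X n → Y) (hπ : ∀ n, IsLocalHomeomorph (π n)) (hi : ∀ n, Function.Injective (π n))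
    (hm : Monotone fun n => Set.range (π n)) (hs : ∀ y, ∃ n x, π n x = y) (f : C_c(Y, ℤ)) (n : ℕ) :
    ∃ m, n ≤ m ∧ ∃ f', pushforward (π m) (hπ m) f' = f := by
  obtain ⟨m, hm'⟩ := IsCompact.elim_directed_cover (f.hasCompactSupport' : IsCompact (tsupport f))
    (fun n => Set.range (π n)) (fun n => (hπ n).isOpenMap.isOpen_range)
    (fun y _ => by
      obtain ⟨n, x, h⟩ := hs y
      exact Set.mem_iUnion.mpr ⟨n, x, h⟩) hm.directed_le
  -- The stage is pushed beyond the prescribed `n`, so that a chain given at stage `n` can be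
  -- compared with `f'`.
  exact ⟨max n m, le_max_left _ _,
    exists_pushforward_eq _ (hi _) f (hm'.trans (hm (le_max_right n m)))⟩

namespace EtaleGroupoid.OpenSubgroupoid

variable {G : EtaleGroupoid}

section Functoriality

variable {K L M : OpenSubgroupoid G} (h₁ : K.carrier ⊆ L.carrier) (h₂ : L.carrier ⊆ M.carrier)

theorem inclusion_chain₀_inclusion_chain₀ (f : C_c(K.toEtale.Ob, ℤ)) :
    (inclusion h₂).chain₀ ((inclusion h₁).chain₀ f) = (inclusion (h₁.trans h₂)).chain₀ f :=
  pushforward_comp (inclusion h₁).isLocalHomeomorph_onOb (inclusion h₂).isLocalHomeomorph_onOb f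

theorem inclusion_chain₁_inclusion_chain₁ (f : C_c(K.toEtale.Arr, ℤ)) :
    (inclusion h₂).chain₁ ((inclusion h₁).chain₁ f) = (inclusion (h₁.trans h₂)).chain₁ f :=
  pushforward_comp (inclusion h₁).isLocalHomeomorph_onArr (inclusion h₂).isLocalHomeomorph_onArr f

theorem inclusion_mapH₀_inclusion_mapH₀ (x : K.toEtale.H₀) :
    (inclusion h₂).mapH₀ ((inclusion h₁).mapH₀ x) = (inclusion (h₁.trans h₂)).mapH₀ x := by
  induction x using QuotientAddGroup.induction_on with
  | H f =>
    exact congrArg (QuotientAddGroup.mk (s := M.toEtale.δ₁.range))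
      (inclusion_chain₀_inclusion_chain₀ h₁ h₂ f)

theorem inclusion_mapH₁_inclusion_mapH₁ (x : K.toEtale.H₁) :
    (inclusion h₂).mapH₁ ((inclusion h₁).mapH₁ x) = (inclusion (h₁.trans h₂)).mapH₁ x := by
  induction x using QuotientAddGroup.induction_on with
  | H f =>
    exact congrArg
      (QuotientAddGroup.mk (s := M.toEtale.δ₂.range.addSubgroupOf M.toEtale.δ₁.ker))
      (Subtype.ext (inclusion_chain₁_inclusion_chain₁ h₁ h₂ f.1))

theorem inclusion_chain₀ (f : C_c(K.toEtale.Ob, ℤ)) : (inclusion h₁).chain₀ f = f :=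
  pushforward_id f _

theorem inclusion_chain₀_injective : Function.Injective (inclusion h₁).chain₀ :=
  pushforward_injective _ Function.injective_id

theorem inclusion_chain₁_injective : Function.Injective (inclusion h₁).chain₁ :=
  pushforward_injective _ (Set.inclusion_injective h₁)

end Functoriality

section Union

/-- The arrow spaces of the `L n` form an increasing open cover, so the compact support of a chain
lies in one of them. -/
theorem exists_inclusion_chain₁_eq (L : ℕ → OpenSubgroupoid G) (K : OpenSubgroupoid G)
    (hL : ∀ {n m}, n ≤ m → (L n).carrier ⊆ (L m).carrier) (hK : ∀ n, (L n).carrier ⊆ K.carrier)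
    (hU : K.carrier ⊆ ⋃ n, (L n).carrier)
    (f : C_c(K.toEtale.Arr, ℤ)) (n : ℕ) :
    ∃ m, n ≤ m ∧ ∃ f', (inclusion (hK m)).chain₁ f' = f := by
  have hr : ∀ n, Set.range (inclusion (hK n)).onArr = {γ : K.toEtale.Arr | γ.1 ∈ (L n).carrier} :=
    fun n => Set.range_inclusion (hK n)
  refine exists_pushforward_eq_of_monotone (fun n => (inclusion (hK n)).onArr)
    (fun n => (inclusion (hK n)).isLocalHomeomorph_onArr)
    (fun n => Set.inclusion_injective (hK n)) ?_ ?_ f n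
  · intro n m h
    simp only [hr]
    exact fun γ hγ => hL h hγ
  · intro γ
    obtain ⟨n, hn⟩ := Set.mem_iUnion.mp (hU γ.2)
    exact ⟨n, ⟨γ.1, hn⟩, rfl⟩

/-- The two arrows of a composable pair lie in a common stage because the union is increasing, so
pairs are exhausted in the same way as arrows. -/
theorem exists_inclusion_chain₂_eq (L : ℕ → OpenSubgroupoid G) (K : OpenSubgroupoid G)
    (hL : ∀ {n m}, n ≤ m → (L n).carrier ⊆ (L m).carrier) (hK : ∀ n, (L n).carrier ⊆ K.carrier)
    (hU : K.carrier ⊆ ⋃ n, (L n).carrier)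
    (f : C_c(K.toEtale.Comp₂, ℤ)) (n : ℕ) :
    ∃ m, n ≤ m ∧ ∃ f', (inclusion (hK m)).chain₂ f' = f := by
  refine exists_pushforward_eq_of_monotone (fun n => (inclusion (hK n)).onComp₂)
    (fun n => (inclusion (hK n)).isLocalHomeomorph_onComp₂) ?_ ?_ ?_ f n
  · intro n p q h
    have h1 := Set.inclusion_injective (hK n) (congrArg (fun p => p.1.1) h)
    have h2 := Set.inclusion_injective (hK n) (congrArg (fun p => p.1.2) h)
    exact Subtype.ext (Prod.ext h1 h2)
  · rintro n m h _ ⟨p, rfl⟩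
    exact ⟨(inclusion (hL h)).onComp₂ p, rfl⟩
  · intro p
    obtain ⟨n, hn⟩ := Set.mem_iUnion.mp (hU p.1.1.2)
    obtain ⟨m, hm⟩ := Set.mem_iUnion.mp (hU p.1.2.2)
    exact ⟨max n m, ⟨(⟨p.1.1.1, hL (le_max_left _ _) hn⟩, ⟨p.1.2.1, hL (le_max_right _ _) hm⟩),
      p.2⟩, rfl⟩

/-- `H₀` commutes with increasing unions of open subgroupoids. -/
theorem exists_directLimit_H₀_equiv (L : ℕ → OpenSubgroupoid G) (K : OpenSubgroupoid G)
    (hL : ∀ {n m}, n ≤ m → (L n).carrier ⊆ (L m).carrier) (hK : ∀ n, (L n).carrier ⊆ K.carrier)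
    (hU : K.carrier ⊆ ⋃ n, (L n).carrier) :
    ∃ e : AddCommGroup.DirectLimit (fun n => (L n).toEtale.H₀)
        (fun _ _ h => (inclusion (hL h)).mapH₀) ≃+ K.toEtale.H₀,
      ∀ n x, e (AddCommGroup.DirectLimit.of _ _ n x) = (inclusion (hK n)).mapH₀ x := by
  refine exists_directLimit_addEquiv _ (fun n => (inclusion (hK n)).mapH₀)
    (fun n m h x => inclusion_mapH₀_inclusion_mapH₀ (hL h) (hK m) x) (fun y => ?_) fun n x hx => ?_
  · induction y using QuotientAddGroup.induction_on with
    | H f => exact ⟨0, QuotientAddGroup.mk (s := (L 0).toEtale.δ₁.range) f,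
        congrArg (QuotientAddGroup.mk (s := K.toEtale.δ₁.range)) (inclusion_chain₀ (hK 0) f)⟩
  · induction x using QuotientAddGroup.induction_on with
    | H f =>
      obtain ⟨g, hg⟩ := (QuotientAddGroup.eq_zero_iff _).mp hx
      -- A chain in `K` bounding the image of `f` lives at a stage `m ≥ n`; injectivity of the
      -- inclusion on chains brings the equation down to that stage.
      obtain ⟨m, h, g', rfl⟩ := exists_inclusion_chain₁_eq L K hL hK hU g n
      refine ⟨m, h, (QuotientAddGroup.eq_zero_iff _).mpr ⟨g', ?_⟩⟩
      apply inclusion_chain₀_injective (hK m)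
      rw [← EtaleHom.δ₁_chain₁, hg]
      exact (inclusion_chain₀_inclusion_chain₀ (hL h) (hK m) f).symm

/-- `H₁` commutes with increasing unions of open subgroupoids. -/
theorem exists_directLimit_H₁_equiv (L : ℕ → OpenSubgroupoid G) (K : OpenSubgroupoid G)
    (hL : ∀ {n m}, n ≤ m → (L n).carrier ⊆ (L m).carrier) (hK : ∀ n, (L n).carrier ⊆ K.carrier)
    (hU : K.carrier ⊆ ⋃ n, (L n).carrier) :
    ∃ e : AddCommGroup.DirectLimit (fun n => (L n).toEtale.H₁)
        (fun _ _ h => (inclusion (hL h)).mapH₁) ≃+ K.toEtale.H₁,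
      ∀ n x, e (AddCommGroup.DirectLimit.of _ _ n x) = (inclusion (hK n)).mapH₁ x := by
  refine exists_directLimit_addEquiv _ (fun n => (inclusion (hK n)).mapH₁)
    (fun n m h x => inclusion_mapH₁_inclusion_mapH₁ (hL h) (hK m) x) (fun y => ?_) fun n x hx => ?_
  · induction y using QuotientAddGroup.induction_on with
    | H f =>
      obtain ⟨f, hf⟩ := f
      obtain ⟨m, -, f', rfl⟩ := exists_inclusion_chain₁_eq L K hL hK hU f 0
      -- The chain at stage `m` is a cycle there, because its boundary vanishes after an injective
      -- map.
      have hf' : (L m).toEtale.δ₁ f' = 0 := by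
        apply inclusion_chain₀_injective (hK m)
        rw [← EtaleHom.δ₁_chain₁, map_zero]
        exact hf
      exact ⟨m, QuotientAddGroup.mk ⟨f', hf'⟩, rfl⟩
  · induction x using QuotientAddGroup.induction_on with
    | H f =>
      obtain ⟨g, hg⟩ := (QuotientAddGroup.eq_zero_iff _).mp hx
      obtain ⟨m, h, g', rfl⟩ := exists_inclusion_chain₂_eq L K hL hK hU g n
      refine ⟨m, h, (QuotientAddGroup.eq_zero_iff _).mpr ⟨g', ?_⟩⟩
      apply inclusion_chain₁_injective (hK m)
      rw [← EtaleHom.δ₂_chain₂, hg]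
      exact (inclusion_chain₁_inclusion_chain₁ (hL h) (hK m) f.1).symm

end Union

end EtaleGroupoid.OpenSubgroupoid

/-! ### Upper bound for the first homology: relations between classes of bisections. -/

namespace SelfSimilarDihedral

open GermArr

/-- Restricting to the sub-bisection over `Z(βw)` does not change germs, and there `(α, g, β)` may
be replaced by `(α(g · w), g|_w, βw)`. -/
theorem germSec_app (i : Triple) (h : i.α.length = i.β.length) (w : List Bool)
    (h' : (i.ext w).α.length = (i.ext w).β.length) :
    germSec i h ∘ app w = germSec (i.ext w) h' := by
  funext z
  have key : ofTriple i (app i.β (app w z)) (app_mem_cyl _ _) =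
      ofTriple (i.ext w) (app (i.β ++ w) z) (app_mem_cyl _ _) := by
    refine ofTriple_eq_iff.mpr ⟨(app_append _ _ _).symm, ?_⟩
    rw [← app_append]
    filter_upwards [(isOpen_cyl (i.β ++ w)).mem_nhds (app_mem_cyl _ z)] with y hy
    exact (i.ext_S w hy).symm
  exact Subtype.ext key

theorem chainSec_pushApp (i : Triple) (h : i.α.length = i.β.length) (w : List Bool)
    (h' : (i.ext w).α.length = (i.ext w).β.length) (f : C_c(Cantor, ℤ)) :
    chainSec i h (pushApp w f) = chainSec (i.ext w) h' f := by
  rw [chainSec, pushApp, pushforward_comp]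
  exact pushforward_congr _ (germSec_app i h w h') f

section Product

variable (α β γ : List Bool) (g h : Γ) (h₁ : α.length = β.length) (h₂ : β.length = γ.length)

/-- The section `z ↦ ([α, g, β; β (h · z)], [β, h, γ; γ z])` of composable pairs. -/
def pairSec (z : Cantor) : K.Comp₂ :=
  ⟨(germSec ⟨α, g, β⟩ h₁ (act h z), germSec ⟨β, h, γ⟩ h₂ z), (Triple.S_app ⟨β, h, γ⟩ z).symm⟩

theorem d₁_pairSec :
    K.d₁ ∘ pairSec α β γ g h h₁ h₂ = germSec ⟨α, g * h, γ⟩ (h₁.trans h₂) := by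
  funext z
  refine Subtype.ext (mul_ofTriple (i := ⟨α, g, β⟩) (j := ⟨β, h, γ⟩) (k := ⟨α, g * h, γ⟩)
    (app_mem_cyl _ _) (app_mem_cyl _ _) (Triple.S_app ⟨β, h, γ⟩ z).symm (app_mem_cyl _ _) ?_)
  filter_upwards [(isOpen_cyl γ).mem_nhds (app_mem_cyl γ z)]
  rintro _ ⟨y, rfl⟩
  have h1 : Triple.S ⟨α, g * h, γ⟩ (app γ y) = app α (act (g * h) y) := Triple.S_app ⟨α, g * h, γ⟩ y
  have h2 : Triple.S ⟨β, h, γ⟩ (app γ y) = app β (act h y) := Triple.S_app ⟨β, h, γ⟩ y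
  have h3 : Triple.S ⟨α, g, β⟩ (app β (act h y)) = app α (act g (act h y)) :=
    Triple.S_app ⟨α, g, β⟩ _
  rw [Function.comp, h1, h2, h3, act_mul]

theorem isLocalHomeomorph_pairSec : IsLocalHomeomorph (pairSec α β γ g h h₁ h₂) := by
  refine IsLocalHomeomorph.of_comp (g := K.d₀) ?_ K.isLocalHomeomorph_d₀ ?_
  · exact isLocalHomeomorph_germSec ⟨β, h, γ⟩ h₂
  · exact (((isLocalHomeomorph_germSec _ _).continuous.comp (continuous_act h)).prodMk
      (isLocalHomeomorph_germSec _ _).continuous).subtype_mk _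

/-- The three faces of the pair are the sections of `h`, of `gh`, and of `g` evaluated at `h · z`;
the reparametrisation in the last face produces `pushAct h f`. -/
theorem δ₂_pairSec (f : C_c(Cantor, ℤ)) :
    K.δ₂ (pushforward _ (isLocalHomeomorph_pairSec α β γ g h h₁ h₂) f) =
      chainSec ⟨β, h, γ⟩ h₂ f - chainSec ⟨α, g * h, γ⟩ (h₁.trans h₂) f +
        chainSec ⟨α, g, β⟩ h₁ (pushAct h f) := by
  simp only [EtaleGroupoid.δ₂, AddMonoidHom.add_apply, AddMonoidHom.sub_apply, chainSec, pushAct,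
    pushforward_comp]
  congr 2
  exact pushforward_congr _ (d₁_pairSec α β γ g h h₁ h₂) f

end Product

/-- One-chains modulo boundaries. -/
abbrev Q : Type := C_c(K.Arr, ℤ) ⧸ K.δ₂.range

/-- The class of the indicator function of the bisection `{[α, g, β; β z]}`. -/
noncomputable def cls (α : List Bool) (g : Γ) (β : List Bool) (h : α.length = β.length) : Q :=
  QuotientAddGroup.mk (chainSec ⟨α, g, β⟩ h oneC)

/-- The constant function is invariant under `pushAct`, so the boundary of the section of composable
pairs is exactly the additivity relation. The product is passed as an equation so that simplified
forms of it can be used. -/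
theorem cls_mul {α β γ : List Bool} {g h k : Γ} (hk : g * h = k) (h₁ : α.length = β.length)
    (h₂ : β.length = γ.length) :
    cls α k γ (h₁.trans h₂) = cls α g β h₁ + cls β h γ h₂ := by
  subst hk
  have h3 : (QuotientAddGroup.mk (K.δ₂ (pushforward _
      (isLocalHomeomorph_pairSec α β γ g h h₁ h₂) oneC)) : Q) = 0 :=
    (QuotientAddGroup.eq_zero_iff _).mpr ⟨_, rfl⟩
  rw [δ₂_pairSec, pushAct_oneC] at h3
  change cls β h γ h₂ - cls α (g * h) γ (h₁.trans h₂) + cls α g β h₁ = 0 at h3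
  rw [sub_add_eq_add_sub, sub_eq_zero] at h3
  rw [← h3, add_comm]

theorem cls_one_self (α : List Bool) : cls α 1 α rfl = 0 := by
  have := cls_mul (one_mul (1 : Γ)) (rfl : α.length = α.length) rfl
  simpa using this

theorem cls_one_symm {α β : List Bool} (h : α.length = β.length) :
    cls β 1 α h.symm = -cls α 1 β h := by
  have := cls_mul (one_mul (1 : Γ)) h h.symm
  rw [cls_one_self] at this
  exact (neg_eq_of_add_eq_zero_right this.symm).symm

/-- The decomposition `1 = 1_{Z(0)} + 1_{Z(1)}` cuts the bisection into its restrictions to `Z(β0)`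
and `Z(β1)`. -/
theorem cls_split {α β : List Bool} (g : Γ) (h : α.length = β.length) : cls α g β h =
    cls (α ++ [out g false]) (sec g false) (β ++ [false]) (by simp [h]) +
      cls (α ++ [out g true]) (sec g true) (β ++ [true]) (by simp [h]) := by
  rw [cls, ← oneC_eq, map_add, chainSec_pushApp _ _ _ (by simp [Triple.ext, actW, h]),
    chainSec_pushApp _ _ _ (by simp [Triple.ext, actW, h])]
  rfl

/-- Since `a` swaps the letters with trivial sections, its two halves are `(α1, e, α0)` and `(α0, e,
α1)`, which are inverse to each other. -/
theorem cls_a (α : List Bool) : cls α a α rfl = 0 := by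
  obtain ⟨⟨h1, h2⟩, ⟨h3, h4⟩, -⟩ := relations
  rw [cls_split]
  simp only [h1, h2, h3, h4]
  rw [cls_one_symm (α := α ++ [false]) (β := α ++ [true]) (by simp), neg_add_cancel]

/-- The class of `[∅, b, ∅]`. -/
noncomputable def clsB : Q := cls [] b [] rfl

/-- The triple `(α, b, β)` factors both as `(α, e, β)(β, b, β)` and as `(α, b, α)(α, e, β)`; the
matrix unit cancels. -/
theorem cls_b_eq {α β : List Bool} (h : α.length = β.length) : cls α b α rfl = cls β b β rfl := by
  have h1 := cls_mul (_root_.one_mul b) h rfl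
  have h2 := cls_mul (_root_.mul_one b) rfl h
  rw [h2, add_comm] at h1
  exact add_left_cancel h1

/-- The half of `b` over the letter `0` is `a`, which contributes nothing; the half over `1` is `b`
again. -/
theorem cls_b_append (α : List Bool) : cls α b α rfl = cls (α ++ [true]) b (α ++ [true]) rfl := by
  obtain ⟨-, -, ⟨h1, h2⟩, ⟨h3, h4⟩⟩ := relations
  rw [cls_split]
  simp only [h1, h2, h3, h4]
  rw [cls_a, zero_add]

theorem cls_b (α : List Bool) : cls α b α rfl = clsB := by
  have h : ∀ n, cls (List.replicate n true) b (List.replicate n true) rfl = clsB := by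
    intro n
    induction n with
    | zero => rfl
    | succ n ih =>
      rw [← ih, cls_b_append (List.replicate n true)]
      exact cls_b_eq (by simp)
  rw [← h α.length]
  exact cls_b_eq (by simp)

theorem two_zsmul_clsB : (2 : ℤ) • clsB = 0 := by
  have := cls_mul sq_relations.2 (rfl : ([] : List Bool).length = [].length) rfl
  rw [cls_one_self] at this
  rw [two_zsmul]
  exact this.symm

/-- For fixed `α` the class is a homomorphism in `g` that kills `a` and sends `b` to `clsB`, and
`a`, `b` generate `Γ`. -/
theorem cls_self_mem (g : Γ) (α : List Bool) : cls α g α rfl ∈ AddSubgroup.zmultiples clsB := by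
  have hg : g ∈ Subgroup.closure {a, b} := by rw [closure_ab]; trivial
  induction hg using Subgroup.closure_induction with
  | mem x hx =>
    obtain rfl | rfl := hx
    · rw [cls_a]
      exact zero_mem _
    · rw [cls_b]
      exact AddSubgroup.mem_zmultiples _
  | one =>
    rw [cls_one_self]
    exact zero_mem _
  | mul x y _ _ hx hy =>
    rw [cls_mul (rfl : x * y = _) rfl rfl]
    exact add_mem hx hy
  | inv x _ hx =>
    have := cls_mul (mul_inv_cancel x) (rfl : α.length = α.length) rfl
    rw [cls_one_self] at this
    rw [← neg_eq_of_add_eq_zero_right this.symm]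
    exact neg_mem hx

/-- The classes carried by the elementary groupoid of matrix units of size `2ⁿ`. -/
noncomputable def elementary (n : ℕ) : AddSubgroup Q :=
  AddSubgroup.closure {x | ∃ α β h, α.length = n ∧ x = cls α 1 β h}

theorem elementary_mono : Monotone elementary := by
  refine monotone_nat_of_le_succ fun n => (AddSubgroup.closure_le _).mpr ?_
  rintro _ ⟨α, β, h, rfl, rfl⟩
  rw [cls_split]
  simp only [out_one, sec_one]
  exact add_mem (AddSubgroup.subset_closure ⟨_, _, _, by simp, rfl⟩)
    (AddSubgroup.subset_closure ⟨_, _, _, by simp, rfl⟩)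

/-- The factorisation `(α, g, β) = (α, g, α)(α, e, β)` separates a multiple of `clsB` from a matrix
unit. Subdividing matrix units brings finitely many of them to one common length. -/
theorem exists_sub_zsmul_mem_elementary (x : Q) : ∃ n, ∃ k : ℤ, x - k • clsB ∈ elementary n := by
  let S : AddSubgroup Q :=
    { carrier := {x | ∃ n, ∃ k : ℤ, x - k • clsB ∈ elementary n}
      zero_mem' := ⟨0, 0, by simp⟩
      add_mem' := by
        rintro x y ⟨n, k, hk⟩ ⟨m, l, hl⟩
        refine ⟨max n m, k + l, ?_⟩
        convert add_mem (elementary_mono (le_max_left n m) hk)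
          (elementary_mono (le_max_right n m) hl) using 1
        module
      neg_mem' := by
        rintro x ⟨n, k, hk⟩
        refine ⟨n, -k, ?_⟩
        convert neg_mem hk using 1
        module }
  induction x using QuotientAddGroup.induction_on with
  | H f =>
    refine mem_of_forall_chainSec_mem (S.comap (QuotientAddGroup.mk' _)) (fun i h f => ?_) f
    refine mem_of_forall_pushApp_mem (S.comap ((QuotientAddGroup.mk' _).comp (chainSec i h)))
      (fun w => ?_) f
    have hl : (i.ext w).α.length = (i.ext w).β.length := by simp [Triple.ext, length_actW, h]
    rw [AddSubgroup.mem_comap, AddMonoidHom.comp_apply, chainSec_pushApp i h w hl]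
    generalize i.ext w = j at hl
    obtain ⟨α, g, β⟩ := j
    obtain ⟨k, hk⟩ := cls_self_mem g α
    refine ⟨α.length, k, ?_⟩
    have h1 : cls α g β hl = _ := cls_mul (_root_.mul_one g) rfl hl
    change cls α g β hl - _ ∈ _
    rw [h1, ← hk, add_sub_cancel_left]
    exact AddSubgroup.subset_closure ⟨_, _, _, rfl, rfl⟩

/-- The boundary of a class of one-chains. -/
noncomputable def boundaryQ : Q →+ C_c(Cantor, ℤ) :=
  QuotientAddGroup.lift _ boundary (by
    rintro _ ⟨F, rfl⟩
    exact K.δ₁_δ₂ F)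

theorem boundaryQ_cls {α β : List Bool} (g : Γ) (h : α.length = β.length) :
    boundaryQ (cls α g β h) = pushApp β oneC - pushApp α oneC :=
  (boundary_chainSec ⟨α, g, β⟩ h oneC).trans (by rw [pushAct_oneC])

/-- Matrix units of one length form a principal groupoid, so they carry no first homology.
Concretely, `wordSum n F` recovers an elementary class from its boundary. -/
theorem eq_zero_of_mem_elementary {n : ℕ} {x : Q} (hx : x ∈ elementary n)
    (h : boundaryQ x = 0) : x = 0 := by
  -- The weight of `w` is minus the class of the matrix unit from `0^n` to `w`, so `F β - F α`
  -- equals the class of `(α, e, β)`.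
  let F : List Bool → Q := fun w => -cls w 1 (List.replicate w.length false) (by simp)
  have key : elementary n ≤
      AddMonoidHom.eqLocus ((wordSum n F).comp boundaryQ) (AddMonoidHom.id Q) := by
    refine (AddSubgroup.closure_le _).mpr ?_
    rintro _ ⟨α, β, h, rfl, rfl⟩
    change wordSum α.length F (boundaryQ (cls α 1 β h)) = cls α 1 β h
    have hβ : wordSum α.length F (pushApp β oneC) = F β := by rw [h, wordSum_pushApp]
    have h1 := cls_mul (_root_.one_mul (1 : Γ)) h (γ := List.replicate β.length false) (by simp)
    rw [boundaryQ_cls, map_sub, wordSum_pushApp, hβ]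
    simp only [F, h, h1]
    abel
  have h1 : wordSum n F (boundaryQ x) = x := key hx
  rw [← h1, h, map_zero]

/-- Every one-cycle is homologous to a multiple of the class of `[∅, b, ∅]`. -/
theorem exists_zsmul_clsB (f : C_c(K.Arr, ℤ)) (hf : boundary f = 0) :
    ∃ k : ℤ, (QuotientAddGroup.mk f : Q) = k • clsB := by
  obtain ⟨n, k, hk⟩ := exists_sub_zsmul_mem_elementary (QuotientAddGroup.mk f)
  -- The class `clsB` is a cycle, so the elementary remainder of a cycle has zero boundary.
  refine ⟨k, sub_eq_zero.mp (eq_zero_of_mem_elementary hk ?_)⟩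
  have h1 : boundaryQ (QuotientAddGroup.mk f) = 0 := hf
  rw [map_sub, map_zsmul, clsB, boundaryQ_cls, h1, sub_self, smul_zero, sub_zero]

end SelfSimilarDihedral

/-! ### Lower bound for the first homology: a `ℤ/2`-valued homomorphism supported on germs at the
words `w1^∞`. -/

namespace SelfSimilarDihedral

open GermArr

/-- The infinite word `1^∞`, whose stabilizer is generated by `b`. -/
def ones : Cantor := fun _ => true

theorem app_ones (n : ℕ) : app (List.replicate n true) ones = ones := by
  induction n with
  | zero => rfl
  | succ n ih =>
    rw [List.replicate_succ, app, ih]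
    exact cons_tail ones

theorem germSec_app_apply (α β : List Bool) (g : Γ) (h : α.length = β.length) (w : List Bool)
    (z : Cantor) : germSec ⟨α, g, β⟩ h (app w z) =
      germSec ⟨α ++ actW g w, secW g w, β ++ w⟩ (by simp [h, length_actW]) z :=
  congrFun (germSec_app ⟨α, g, β⟩ h w (by simp [Triple.ext, h, length_actW])) z

theorem mul_germSec (α β γ : List Bool) (g h : Γ) (h₁ : α.length = β.length)
    (h₂ : β.length = γ.length) (z : Cantor)
    (e : K.src (germSec ⟨α, g, β⟩ h₁ (act h z)) = K.rng (germSec ⟨β, h, γ⟩ h₂ z)) :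
    K.mul (germSec ⟨α, g, β⟩ h₁ (act h z)) (germSec ⟨β, h, γ⟩ h₂ z) e =
      germSec ⟨α, g * h, γ⟩ (h₁.trans h₂) z :=
  congrFun (d₁_pairSec α β γ g h h₁ h₂) z

theorem rng_germSec_apply (α β : List Bool) (g : Γ) (h : α.length = β.length) (z : Cantor) :
    K.rng (germSec ⟨α, g, β⟩ h z) = app α (act g z) := Triple.S_app ⟨α, g, β⟩ z

/-- Equal lengths force `β = β'` and `z = z'`; the two maps then agree on a cylinder around `z`, and
rigidity determines the group element. -/
theorem germSec_eq_germSec {α β α' β' : List Bool} {g g' : Γ} {h : α.length = β.length}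
    {h' : α'.length = β'.length} {z z' : Cantor}
    (e : germSec ⟨α, g, β⟩ h z = germSec ⟨α', g', β'⟩ h' z') (hl : β.length = β'.length) :
    g = g' := by
  obtain ⟨h1, h2⟩ := ofTriple_eq_iff (i := ⟨α, g, β⟩) (j := ⟨α', g', β'⟩)
    (hx := app_mem_cyl _ _) (hy := app_mem_cyl _ _) |>.mp (congrArg Subtype.val e)
  obtain ⟨rfl, rfl⟩ := app_eq_app hl h1
  obtain ⟨n, -, hn⟩ := exists_cyl_subset
    ((continuous_app β).continuousAt.preimage_mem_nhds h2) 0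
  refine (rigid (u := α) (u' := α') (w := take n z) fun y hy => ?_).2
  have h3 : Triple.S ⟨α, g, β⟩ (app β y) = Triple.S ⟨α', g', β⟩ (app β y) := hn hy
  have h4 : Triple.S ⟨α, g, β⟩ (app β y) = app α (act g y) := Triple.S_app ⟨α, g, β⟩ y
  have h5 : Triple.S ⟨α', g', β⟩ (app β y) = app α' (act g' y) := Triple.S_app ⟨α', g', β⟩ y
  rw [← h4, h3, h5]

/-- The elements of the stabilizer of `1^∞`. -/
def Stable (g : Γ) : Prop := out g true = true ∧ sec g true = g

theorem stable_one : Stable 1 := ⟨out_one _, sec_one _⟩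

theorem stable_b : Stable b := relations.2.2.2

theorem Stable.actW {g : Γ} (hg : Stable g) (n : ℕ) :
    actW g (List.replicate n true) = List.replicate n true := by
  induction n with
  | zero => rfl
  | succ n ih => rw [List.replicate_succ, SelfSimilarDihedral.actW, hg.1, hg.2, ih]

theorem Stable.secW {g : Γ} (hg : Stable g) (n : ℕ) : secW g (List.replicate n true) = g := by
  induction n with
  | zero => rfl
  | succ n ih => rw [List.replicate_succ, SelfSimilarDihedral.secW, hg.2, ih]

theorem Stable.act_ones {g : Γ} (hg : Stable g) : act g ones = ones := by
  funext n
  induction n with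
  | zero => exact hg.1
  | succ n ih =>
    have h : act g ones (n + 1) = act (sec g true) ones n := rfl
    rw [h, hg.2, ih]
    rfl

/-- The germ `γ` has the form `[α, g, β; β 1^∞]`. -/
def IsTailGerm (g : Γ) (γ : K.Arr) : Prop := ∃ α β h, γ = germSec ⟨α, g, β⟩ h ones

/-- Such a `g` fixes `1^n` with section `g`, so both words can be padded with ones while the group
element stays the same. This is how two representatives are brought to a common length. -/
theorem Stable.germSec_ones {g : Γ} (hg : Stable g) (α β : List Bool) (h : α.length = β.length)
    (n : ℕ) : germSec ⟨α, g, β⟩ h ones =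
      germSec ⟨α ++ List.replicate n true, g, β ++ List.replicate n true⟩ (by simp [h]) ones := by
  have := germSec_app_apply α β g h (List.replicate n true) ones
  simp only [app_ones, hg.actW, hg.secW] at this
  exact this

/-- Padding each word by the length of the other makes the domains equally long, and rigidity
applies. -/
theorem IsTailGerm.eq {g g' : Γ} (hg : Stable g) (hg' : Stable g') {γ : K.Arr}
    (h : IsTailGerm g γ) (h' : IsTailGerm g' γ) : g = g' := by
  obtain ⟨α, β, hl, rfl⟩ := h
  obtain ⟨α', β', hl', e⟩ := h'
  rw [hg.germSec_ones α β hl β'.length, hg'.germSec_ones α' β' hl' β.length] at e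
  exact germSec_eq_germSec e (by simp [add_comm])

/-- After padding, the domain word of `γ` and the range word of `δ` have the same length and are
prefixes of the same point, hence coincide; the product formula for triples then applies. -/
theorem IsTailGerm.mul {g g' : Γ} (hg : Stable g) (hg' : Stable g') {γ δ : K.Arr}
    (h : IsTailGerm g γ) (h' : IsTailGerm g' δ) (e : K.src γ = K.rng δ) :
    IsTailGerm (g * g') (K.mul γ δ e) := by
  obtain ⟨α, β, hl, rfl⟩ := h
  obtain ⟨α', β', hl', rfl⟩ := h'
  have h1 := hg.germSec_ones α β hl β'.length
  have h2 := hg'.germSec_ones α' β' hl' β.length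
  generalize germSec ⟨α, g, β⟩ hl ones = γ at *
  generalize germSec ⟨α', g', β'⟩ hl' ones = δ at *
  subst h1 h2
  have e' := e
  rw [rng_germSec_apply, hg'.act_ones] at e'
  obtain ⟨h3, -⟩ := app_eq_app (by simp [hl', add_comm]) (show app _ ones = app _ ones from e')
  refine ⟨α ++ List.replicate β'.length true, β' ++ List.replicate β.length true,
    by simp [hl, add_comm], ?_⟩
  -- The two middle words are made variables so that their equality can be substituted inside the
  -- dependent product.
  have key : ∀ (β₁ β₂ : List Bool) (h₁ : _ = β₁.length) (h₂ : β₂.length = _) (_ : β₁ = β₂)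
      (e : K.src (germSec ⟨α ++ List.replicate β'.length true, g, β₁⟩ h₁ ones) =
        K.rng (germSec ⟨β₂, g', β' ++ List.replicate β.length true⟩ h₂ ones)),
      K.mul _ _ e = germSec ⟨α ++ List.replicate β'.length true, g * g',
        β' ++ List.replicate β.length true⟩ (by simp [hl, add_comm]) ones := by
    rintro β₁ _ h₁ h₂ rfl e
    have := mul_germSec _ β₁ _ g g' h₁ h₂ ones
    simp only [hg'.act_ones] at this
    exact this e
  exact key _ _ _ _ h3 e

/-- The infinite word `x` is of the form `w 1^∞`. -/
def IsTail (x : Cantor) : Prop := ∃ w, x = app w ones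

theorem IsTail.of_app {w : List Bool} {z : Cantor} (h : IsTail (app w z)) : IsTail z := by
  obtain ⟨v, hv⟩ := h
  -- Padding by `|w|` ones makes the prefix at least as long as `w`, so that it extends `w`.
  have h1 : app w z = app (v ++ List.replicate w.length true) ones := by
    rw [hv, app_append, app_ones]
  obtain ⟨u, hu⟩ := exists_append (w := w) (v := v ++ List.replicate w.length true) (by simp)
    (app_mem_cyl w z) (h1 ▸ app_mem_cyl _ _)
  rw [hu, app_append] at h1
  exact ⟨u, app_injective w h1⟩

theorem IsTailGerm.isTail_src {g : Γ} {γ : K.Arr} (h : IsTailGerm g γ) : IsTail (K.src γ) := by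
  obtain ⟨α, β, hl, rfl⟩ := h
  exact ⟨β, rfl⟩

theorem IsTailGerm.isTail_rng {g : Γ} (hg : Stable g) {γ : K.Arr} (h : IsTailGerm g γ) :
    IsTail (K.rng γ) := by
  obtain ⟨α, β, hl, rfl⟩ := h
  refine ⟨α, ?_⟩
  rw [rng_germSec_apply, hg.act_ones]

theorem secW_append (g : Γ) (u v : List Bool) : secW g (u ++ v) = secW (secW g u) v := by
  induction u generalizing g with
  | nil => rfl
  | cons x u ih => exact ih _

theorem sec_r_true (i : ℤ) : sec (.r i) true =
    if Even i then .r (i / 2 : ℤ) else .sr (i / 2 + 1 : ℤ) := rfl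

theorem sec_sr_true (i : ℤ) : sec (.sr i) true =
    if Even i then .r (i / 2 : ℤ) else .sr (i / 2 + 1 : ℤ) := rfl

/-- The sections along `1^∞` of every element are eventually `1` or `b`. -/
theorem exists_secW_replicate (g : Γ) : ∃ n, secW g (List.replicate n true) = 1 ∨
    secW g (List.replicate n true) = b := by
  -- The section at `1` depends only on the index `i`, for rotations and reflections alike: it has
  -- index `i/2` for even `i` and `i/2 + 1` for odd `i`. The absolute value drops except at `i = 0`
  -- and `i = 1`, whose sections are `1` and `b`.
  have key : ∀ m : ℕ, ∀ i : ℤ, i.natAbs ≤ m → ∀ g : Γ, g = .r i ∨ g = .sr i →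
      ∃ n, secW g (List.replicate n true) = 1 ∨ secW g (List.replicate n true) = b := by
    intro m
    induction m with
    | zero =>
      rintro i hi g hg
      obtain rfl : i = 0 := by omega
      refine ⟨1, Or.inl ?_⟩
      obtain rfl | rfl := hg <;> decide
    | succ m ih =>
      intro i hi g hg
      have hs : sec g true = if Even i then .r (i / 2 : ℤ) else .sr (i / 2 + 1 : ℤ) := by
        obtain rfl | rfl := hg
        · exact sec_r_true i
        · exact sec_sr_true i
      by_cases h1 : i = 1
      · refine ⟨1, Or.inr ?_⟩
        subst h1
        obtain rfl | rfl := hg <;> decide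
      by_cases he : Even i
      · rw [if_pos he] at hs
        obtain ⟨j, hj⟩ := he
        by_cases h0 : i = 0
        · refine ⟨1, Or.inl ?_⟩
          subst h0
          obtain rfl | rfl := hg <;> decide
        obtain ⟨n, hn⟩ := ih (i / 2) (by omega) _ (Or.inl hs)
        exact ⟨n + 1, hn⟩
      · rw [if_neg he] at hs
        rw [Int.not_even_iff_odd] at he
        obtain ⟨j, hj⟩ := he
        obtain ⟨n, hn⟩ := ih (i / 2 + 1) (by omega) _ (Or.inr hs)
        exact ⟨n + 1, hn⟩
  rcases g with (i : ℤ) | (i : ℤ)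
  · exact key _ i le_rfl _ (Or.inl rfl)
  · exact key _ i le_rfl _ (Or.inr rfl)

/-- Restricting the germ to a cylinder `Z(βv1^n)` with `n` large replaces `g` by a section that is
`1` or `b`. -/
theorem isTailGerm_of_isTail_src {γ : K.Arr} (h : IsTail (K.src γ)) :
    IsTailGerm 1 γ ∨ IsTailGerm b γ := by
  obtain ⟨⟨α, g, β⟩, hl, z, rfl⟩ := exists_germSec γ
  obtain ⟨v, rfl⟩ := IsTail.of_app (w := β) (z := z) h
  obtain ⟨n, hn⟩ := exists_secW_replicate (secW g v)
  rw [← secW_append] at hn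
  have h1 : app v ones = app (v ++ List.replicate n true) ones := by rw [app_append, app_ones]
  rw [h1, germSec_app_apply]
  obtain hn | hn := hn
  · exact Or.inl ⟨α ++ actW g (v ++ List.replicate n true), β ++ (v ++ List.replicate n true),
      by simpa [length_actW] using hl, by simp only [hn]⟩
  · exact Or.inr ⟨α ++ actW g (v ++ List.replicate n true), β ++ (v ++ List.replicate n true),
      by simpa [length_actW] using hl, by simp only [hn]⟩

/-- The inverse germ starts at a tail of ones, so it is of type `1` or `b`, and both types end at
such a tail. -/
theorem isTail_src_of_isTail_rng {γ : K.Arr} (h : IsTail (K.rng γ)) : IsTail (K.src γ) := by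
  rw [← K.src_inv γ] at h
  rw [← K.rng_inv γ]
  obtain h | h := isTailGerm_of_isTail_src h
  · exact h.isTail_rng stable_one
  · exact h.isTail_rng stable_b

open Classical in
/-- The `ℤ/2`-valued function on `H` that is `1` exactly on the germs `[α, b, β; β 1^∞]`. -/
noncomputable def tau (γ : K.Arr) : ZMod 2 := if IsTailGerm b γ then 1 else 0

theorem tau_of_b {γ : K.Arr} (h : IsTailGerm b γ) : tau γ = 1 := if_pos h

theorem one_ne_b : (1 : Γ) ≠ b := by decide

theorem tau_of_one {γ : K.Arr} (h : IsTailGerm 1 γ) : tau γ = 0 :=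
  if_neg fun h' => one_ne_b (h.eq stable_one stable_b h')

theorem tau_of_not_isTail {γ : K.Arr} (h : ¬ IsTail (K.src γ)) : tau γ = 0 :=
  if_neg fun h' => h h'.isTail_src

/-- `tau` is a homomorphism. -/
theorem tau_mul (γ δ : K.Arr) (e : K.src γ = K.rng δ) : tau (K.mul γ δ e) = tau γ + tau δ := by
  -- Points of the form `w1^∞` form an invariant set, so `γ` and `δ` are both over it or both off
  -- it. Over it, the four cases are the multiplication table of `{1, b}`.
  by_cases h : IsTail (K.src δ)
  · have hδ := isTailGerm_of_isTail_src h
    have hγ : IsTail (K.src γ) := by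
      rw [e]
      obtain h | h := hδ
      · exact h.isTail_rng stable_one
      · exact h.isTail_rng stable_b
    obtain h1 | h1 := isTailGerm_of_isTail_src hγ <;> obtain h2 | h2 := hδ
    · have h3 := h1.mul stable_one stable_one h2 e
      rw [_root_.one_mul] at h3
      rw [tau_of_one h1, tau_of_one h2, tau_of_one h3, add_zero]
    · have h3 := h1.mul stable_one stable_b h2 e
      rw [_root_.one_mul] at h3
      rw [tau_of_one h1, tau_of_b h2, tau_of_b h3, zero_add]
    · have h3 := h1.mul stable_b stable_one h2 e
      rw [_root_.mul_one] at h3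
      rw [tau_of_b h1, tau_of_one h2, tau_of_b h3, add_zero]
    · have h3 := h1.mul stable_b stable_b h2 e
      rw [sq_relations.2] at h3
      rw [tau_of_b h1, tau_of_b h2, tau_of_one h3]
      decide
  · have h1 : ¬ IsTail (K.src γ) := fun h1 => h (isTail_src_of_isTail_rng (e ▸ h1))
    have h2 : ¬ IsTail (K.src (K.mul γ δ e)) := by rwa [K.src_mul]
    rw [tau_of_not_isTail h, tau_of_not_isTail h1, tau_of_not_isTail h2, add_zero]

theorem actW_one (w : List Bool) : actW 1 w = w := by
  induction w with
  | nil => rfl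
  | cons x w ih => rw [actW, out_one, sec_one, ih]

theorem secW_one (w : List Bool) : secW 1 w = 1 := by
  induction w with
  | nil => rfl
  | cons x w ih => rw [secW, sec_one, ih]

theorem tau_germSec_one (α β : List Bool) (h : α.length = β.length) (z : Cantor) :
    tau (germSec ⟨α, 1, β⟩ h z) = 0 := by
  by_cases hz : IsTail z
  · obtain ⟨w, rfl⟩ := hz
    refine tau_of_one ⟨α ++ w, β ++ w, by simp [h], ?_⟩
    rw [germSec_app_apply]
    simp only [actW_one, secW_one]
  · exact tau_of_not_isTail fun h' => hz (IsTail.of_app h')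

theorem germSec_eq_tail (α β : List Bool) (g : Γ) (h : α.length = β.length) (z : Cantor) :
    germSec ⟨α, g, β⟩ h z = germSec ⟨α ++ [out g (z 0)], sec g (z 0), β ++ [z 0]⟩ (by simp [h])
      (tail z) := by
  have h1 := germSec_app_apply α β g h [z 0] (tail z)
  have h2 : app [z 0] (tail z) = z := cons_tail z
  rw [h2] at h1
  exact h1

theorem tau_germSec_a (α β : List Bool) (h : α.length = β.length) (z : Cantor) :
    tau (germSec ⟨α, a, β⟩ h z) = 0 := by
  have h1 : ∀ x, sec a x = 1 := by decide
  rw [germSec_eq_tail]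
  simp only [h1]
  exact tau_germSec_one _ _ _ _

/-- Along a word other than `1^∞` the section of `b` becomes `a` at the first letter `0`, and `tau`
vanishes on the germs of `a`. -/
theorem tau_germSec_b (α β : List Bool) (h : α.length = β.length) {z : Cantor} (hz : z ≠ ones) :
    tau (germSec ⟨α, b, β⟩ h z) = 0 := by
  obtain ⟨-, -, ⟨h1, h2⟩, ⟨h3, h4⟩⟩ := relations
  obtain ⟨n, hn⟩ := Function.ne_iff.mp hz
  replace hn : z n = false := by simpa [ones] using hn
  clear hz
  induction n generalizing α β z with
  | zero =>
    rw [germSec_eq_tail]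
    simp only [hn, h2]
    exact tau_germSec_a _ _ _ _
  | succ n ih =>
    rw [germSec_eq_tail]
    cases h0 : z 0
    -- The position `n` is some zero of `z`, not necessarily the first; an earlier zero ends the
    -- descent at once.
    · simp only [h2]
      exact tau_germSec_a _ _ _ _
    · simp only [h4]
      exact ih _ _ _ hn

theorem tau_germSec_mul (α β γ : List Bool) (g h : Γ) (h₁ : α.length = β.length)
    (h₂ : β.length = γ.length) (z : Cantor) : tau (germSec ⟨α, g * h, γ⟩ (h₁.trans h₂) z) =
      tau (germSec ⟨α, g, β⟩ h₁ (act h z)) + tau (germSec ⟨β, h, γ⟩ h₂ z) :=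
  (congrArg tau (mul_germSec α β γ g h h₁ h₂ z (rng_germSec_apply _ _ _ _ _).symm)).symm.trans
    (tau_mul _ _ _)

/-- The homomorphism property reduces the claim to the generators, where the exceptional set is
empty for `a` and contained in `{1^∞}` for `b`. -/
theorem finite_tau_germSec (g : Γ) (α β : List Bool) (h : α.length = β.length) :
    {z | tau (germSec ⟨α, g, β⟩ h z) ≠ 0}.Finite := by
  have hg : g ∈ Subgroup.closure {a, b} := by rw [closure_ab]; trivial
  induction hg using Subgroup.closure_induction generalizing α β with
  | mem x hx =>
    obtain rfl | rfl := hx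
    · simp [tau_germSec_a]
    · refine (Set.finite_singleton ones).subset fun z hz => ?_
      by_contra hne
      exact hz (tau_germSec_b α β h hne)
  | one => simp [tau_germSec_one]
  | mul x y _ _ hx hy =>
    refine (((hx α α rfl).preimage (actHomeo y).injective.injOn).union (hy α β h)).subset
      fun z hz => ?_
    by_contra hne
    rw [Set.mem_union, not_or] at hne
    have h1 : tau (germSec ⟨α, x, α⟩ rfl (act y z)) = 0 := not_not.mp hne.1
    have h2 : tau (germSec ⟨α, y, β⟩ h z) = 0 := not_not.mp hne.2
    refine hz ?_
    rw [tau_germSec_mul α α β x y rfl h z, h1, h2, add_zero]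
  | inv x _ hx =>
    refine ((hx β α h.symm).preimage (actHomeo x⁻¹).injective.injOn).subset fun z hz => ?_
    by_contra hne
    have h1 : tau (germSec ⟨β, x, α⟩ h.symm (act x⁻¹ z)) = 0 := not_not.mp hne
    have h4 := tau_germSec_mul β α β x x⁻¹ h.symm h z
    rw [h1, zero_add] at h4
    refine hz (h4.symm.trans ?_)
    simp only [mul_inv_cancel]
    exact tau_germSec_one _ _ _ _

/-- A compact set is covered by finitely many bisections, and each meets the support in a finite
set. This replaces continuity, which fails for `tau`: on the bisection of `b` it is nonzero at the
single point `1^∞`. -/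
theorem finite_inter_support_tau (C : Set K.Arr) (hC : IsCompact C) :
    (C ∩ Function.support tau).Finite := by
  refine hC.induction_on (p := fun s => (s ∩ Function.support tau).Finite) (by simp)
    (fun s t hst ht => ht.subset (Set.inter_subset_inter_left _ hst)) (fun s t hs ht => ?_)
    fun γ _ => ?_
  · rw [Set.union_inter_distrib_right]
    exact hs.union ht
  · obtain ⟨⟨α, g, β⟩, hl, z, rfl⟩ := exists_germSec γ
    refine ⟨_, mem_nhdsWithin_of_mem_nhds
      ((isLocalHomeomorph_germSec ⟨α, g, β⟩ hl).isOpenMap.isOpen_range.mem_nhds ⟨z, rfl⟩), ?_⟩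
    refine ((finite_tau_germSec g α β hl).image (germSec ⟨α, g, β⟩ hl)).subset ?_
    rintro _ ⟨⟨y, rfl⟩, hy⟩
    exact ⟨y, hy, rfl⟩

/-- The homomorphism `f ↦ ∑ f(γ)` over the germs `γ = [α, b, β; β 1^∞]`, modulo `2`. -/
noncomputable def sumTau : C_c(K.Arr, ℤ) →+ ZMod 2 := pairing tau finite_inter_support_tau

/-- Pairing with `d₀ - d₁ + d₂` sums the defect of additivity of `tau` over composable pairs, which
is zero. -/
theorem sumTau_δ₂ (F : C_c(K.Comp₂, ℤ)) : sumTau (K.δ₂ F) = 0 := by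
  have h : ∀ p : K.Comp₂, tau (K.d₁ p) = tau (K.d₂ p) + tau (K.d₀ p) := fun p => tau_mul _ _ p.2
  simp only [EtaleGroupoid.δ₂, AddMonoidHom.add_apply, AddMonoidHom.sub_apply, map_add, map_sub,
    sumTau, pairing_pushforward, h, add_mul]
  rw [finsum_add_distrib (finite_support_comp_mul K.isLocalHomeomorph_d₂ finite_inter_support_tau F)
    (finite_support_comp_mul K.isLocalHomeomorph_d₀ finite_inter_support_tau F)]
  abel

theorem sumTau_chainSec_b : sumTau (chainSec ⟨[], b, []⟩ rfl oneC) = 1 := by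
  rw [sumTau, chainSec, pairing_pushforward, finsum_eq_single _ ones]
  · rw [tau_of_b ⟨[], [], rfl, rfl⟩]
    simp [oneC]
  · intro z hz
    rw [tau_germSec_b _ _ _ hz, zero_mul]

/-- `H₁(H) ≅ ℤ/2`. -/
theorem nonempty_H₁_equiv : Nonempty (K.H₁ ≃+ ZMod 2) := by
  let s : C_c(K.Arr, ℤ) := chainSec ⟨[], b, []⟩ rfl oneC
  have hs : K.δ₁ s = 0 := by
    refine (boundary_chainSec ⟨[], b, []⟩ rfl oneC).trans ?_
    rw [pushAct_oneC, sub_self]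
    rfl
  refine nonempty_quotient_addEquiv _ (sumTau.comp K.δ₁.ker.subtype) (fun x => ?_) fun f => ?_
  · refine ⟨(x.val : ℤ) • ⟨s, hs⟩, ?_⟩
    rw [map_zsmul]
    change (x.val : ℤ) • sumTau s = x
    rw [sumTau_chainSec_b]
    simp
  · obtain ⟨f, hf⟩ := f
    change f ∈ K.δ₂.range ↔ sumTau f = 0
    constructor
    · rintro ⟨F, rfl⟩
      exact sumTau_δ₂ F
    · intro h0
      obtain ⟨k, hk⟩ := exists_zsmul_clsB f hf
      have h1 : (QuotientAddGroup.mk (f - k • s) : Q) = 0 := sub_eq_zero.mpr hk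
      obtain ⟨F, hF⟩ := (QuotientAddGroup.eq_zero_iff _).mp h1
      -- Applying `sumTau` to `f - k s` shows that `k` is even, and then `k • clsB = 0`.
      have h2 := sumTau_δ₂ F
      rw [hF, map_sub, map_zsmul, h0, sumTau_chainSec_b, zero_sub, neg_eq_zero, zsmul_one] at h2
      obtain ⟨l, rfl⟩ := (ZMod.intCast_zmod_eq_zero_iff_dvd k 2).mp h2
      refine (QuotientAddGroup.eq_zero_iff _).mp (hk.trans ?_)
      rw [mul_comm, mul_smul]
      exact (congrArg _ two_zsmul_clsB).trans (smul_zero l)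

end SelfSimilarDihedral

theorem mainTheorem7 :
    -- `H₀(H) ≅ ℤ[1/2]` and `H₁(H) ≅ ℤ/2`, where `H = c⁻¹(0)`
    Nonempty (SelfSimilarDihedral.kernel.toEtale.H₀ ≃+ Localization.Away (2 : ℤ)) ∧
    Nonempty (SelfSimilarDihedral.kernel.toEtale.H₁ ≃+ ZMod 2) ∧
    -- both are the inductive limits of the homology of the `H_n`, along the inclusions
    (∃ e : AddCommGroup.DirectLimit (fun n : ℕ => (SelfSimilarDihedral.level n).toEtale.H₀)
          (fun _ _ h => (EtaleGroupoid.OpenSubgroupoid.inclusion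
            (SelfSimilarDihedral.level_mono h)).mapH₀) ≃+
        SelfSimilarDihedral.kernel.toEtale.H₀,
      ∀ (n : ℕ) (x : (SelfSimilarDihedral.level n).toEtale.H₀),
        e (AddCommGroup.DirectLimit.of _ _ n x) =
          (EtaleGroupoid.OpenSubgroupoid.inclusion
            (SelfSimilarDihedral.level_subset_kernel n)).mapH₀ x) ∧
    (∃ e : AddCommGroup.DirectLimit (fun n : ℕ => (SelfSimilarDihedral.level n).toEtale.H₁)
          (fun _ _ h => (EtaleGroupoid.OpenSubgroupoid.inclusion
            (SelfSimilarDihedral.level_mono h)).mapH₁) ≃+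
        SelfSimilarDihedral.kernel.toEtale.H₁,
      ∀ (n : ℕ) (x : (SelfSimilarDihedral.level n).toEtale.H₁),
        e (AddCommGroup.DirectLimit.of _ _ n x) =
          (EtaleGroupoid.OpenSubgroupoid.inclusion
            (SelfSimilarDihedral.level_subset_kernel n)).mapH₁ x) :=
  ⟨SelfSimilarDihedral.nonempty_H₀_equiv, SelfSimilarDihedral.nonempty_H₁_equiv,
    EtaleGroupoid.OpenSubgroupoid.exists_directLimit_H₀_equiv SelfSimilarDihedral.level
      SelfSimilarDihedral.kernel SelfSimilarDihedral.level_mono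
      SelfSimilarDihedral.level_subset_kernel SelfSimilarDihedral.iUnion_level.ge,
    EtaleGroupoid.OpenSubgroupoid.exists_directLimit_H₁_equiv SelfSimilarDihedral.level
      SelfSimilarDihedral.kernel SelfSimilarDihedral.level_mono
      SelfSimilarDihedral.level_subset_kernel SelfSimilarDihedral.iUnion_level.ge⟩
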